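/- Let $I=[0,1]$ and let $K\subset[0,1]$ be the middle third Cantor set. For a finite binary string $a$ let $K_a$ be the corresponding similar copy of $K$: $K_\emptyset=K$, $K_{0a}=\tfrac13K_a$, $K_{1a}=\tfrac13K_a+\tfrac23$. For $n\ge1$, a wormhole level of order $n$ is a number $t=\sum_{i=1}^n m_i3^{-i}$ with $m_i\in\{0,1,2\}$ and $m_n>0$. Let $\sim$ be the equivalence relation on $I\times K$ generated by $(t,s)\sim(t,s+2\cdot3^{-n})$ whenever $n\ge1$, $t$ is a wormhole level of order $n$, and $s\in K_{a0}$ for some binary string $a$ of length $n-1$. Let $F=(I\times K)/\!\sim$ (Laakso space) with the quotient topology and quotient map $q:I\times K\to F$, and put $$d(x,y)=\inf\{\mathcal H^1(p): p\subset I\times K,\ q(p)\text{ is the image of a continuous path in }F\text{ joining }x\text{ and }y\},$$ where $\mathcal H^1$ is one-dimensional Hausdorff measure for the Euclidean metric on $I\times K\subset\mathbb R^2$. For $w\in(0,1)$ let $\nu_w$ be the Borel probability measure on $K$ with $\nu_w(K_a)=w^{z}(1-w)^{N-z}$ for every binary string $a$ of length $N$ with $z$ zeros, and let $\mu_w=q_*(\mathcal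 H^1|_I\times\nu_w)$. **Theorem.** For every $w\in(0,1)$ the metric measure space $(F,d,\mu_w)$ supports a $(1,1)$-Poincaré inequality: there exist constants $C>0$ and $\lambda\ge1$ such that, for every Lipschitz function $f:F\to\mathbb R$ and every ball $B(x,r)=\{y\in F: d(x,y)<r\}$ with $x\in F$ and $r>0$, $$\frac1{\mu_w(B(x,r))}\int_{B(x,r)}|f-f_{B(x,r)}|\,d\mu_w\le C\,r\,\frac1{\mu_w(B(x,\lambda r))}\int_{B(x,\lambda r)}\operatorname{Lip}[f]\,d\mu_w,$$ where $f_B=\frac1{\mu_w(B)}\int_Bf\,d\mu_w$ and $\operatorname{Lip}[f](x)=\limsup_{y\to x,\,y\ne x}\frac{|f(y)-f(x)|}{d(x,y)}$. -/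

import Mathlib

open Set Filter MeasureTheory
open scoped Topology ENNReal NNReal

noncomputable section

/-! ### Analysis on a metric measure space -/

/-- The pointwise Lipschitz constant
`Lip[f](x) = limsup_{y → x, y ≠ x} |f y - f x| / d(y, x)`, with values in `[0, ∞]`. -/
def pointwiseLip {X : Type*} [PseudoEMetricSpace X] (f : X → ℝ) (x : X) : ℝ≥0∞ :=
  limsup (fun y => edist (f y) (f x) / edist y x) (𝓝[≠] x)

/-- `(X, d, μ)` supports a `(1,1)`-Poincaré inequality: there are constants `C > 0` and
`lam ≥ 1` such that, for every Lipschitz function `f : X → ℝ` and every open ball `B(x, r)`,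
the average over `B(x, r)` of `|f - f_B|` is at most `C r` times the average of `Lip[f]` over
`B(x, lam r)`. The two outer averages are averages of nonnegative functions, taken in `[0, ∞]`
(`⨍⁻`); `f_B` is the average of `f` over `B(x, r)` (`⨍`). -/
def SupportsPoincareOneOne (X : Type*) [PseudoEMetricSpace X] [MeasurableSpace X]
    (μ : Measure X) : Prop :=
  ∃ C lam : ℝ≥0, 0 < C ∧ 1 ≤ lam ∧
    ∀ f : X → ℝ, (∃ L : ℝ≥0, LipschitzWith L f) →
      ∀ (x : X) (r : ℝ≥0), 0 < r →
        ⨍⁻ y in Metric.eball x r, ‖f y - ⨍ z in Metric.eball x r, f z ∂μ‖ₑ ∂μ ≤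
          (C : ℝ≥0∞) * r * ⨍⁻ y in Metric.eball x ((lam * r : ℝ≥0) : ℝ≥0∞), pointwiseLip f y ∂μ

/-! ### The Cantor set and its Bernoulli measures -/

/-- The similar copy `K_a` of the middle third Cantor set `K`, for a binary string `a`
(`false` is the digit `0`, `true` is the digit `1`):
`K_∅ = K`, `K_{0a} = (1/3) K_a` and `K_{1a} = (1/3) K_a + 2/3`. -/
def cantorCopy : List Bool → Set ℝ
  | [] => cantorSet
  | b :: a => (fun x : ℝ => x / 3 + cond b (2 / 3) 0) '' cantorCopy a

/-- The probability measure `ν_w` on the Cantor set: the image of the Bernoulli measure on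
`{0,1}^ℕ` whose factors give mass `w` to `0` and `1 - w` to `1`, under the homeomorphism
`(a_i) ↦ ∑ 2 a_i 3^{-i}` (`i ≥ 1`). Thus at every stage of the construction of the Cantor set a
proportion `w` of the mass goes to the left copy and `1 - w` to the right copy. -/
def cantorMeasure (w : unitInterval) : Measure cantorSet :=
  (Measure.infinitePi fun _ : ℕ => ProbabilityTheory.bernoulliMeasure false true w).map
    cantorSetHomeomorphNatToBool.symm

/-! ### Laakso space -/

/-- The product `I × K` of the unit interval and the middle third Cantor set. -/
abbrev IntervalCantor : Type := unitInterval × cantorSet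

/-- `t` is (the height of) a wormhole level of order `n`: `n ≥ 1` and
`t = ∑_{i=1}^n m_i / 3^i` with `m_i ∈ {0,1,2}` and `m_n > 0`. -/
def IsWormholeLevel (n : ℕ) (t : ℝ) : Prop :=
  1 ≤ n ∧ ∃ m : ℕ → Fin 3, 0 < m n ∧ t = ∑ i ∈ Finset.Icc 1 n, ((m i : ℕ) : ℝ) / 3 ^ i

/-- The identifications: if `t` is a wormhole level of order `n` and `a` is a binary string of
length `n - 1`, the point `(t, s)` with `s ∈ K_{a0}` is identified with `(t, s + 2/3^n)`. -/
inductive WormholeRel : IntervalCantor → IntervalCantor → Prop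
  | glue (n : ℕ) (t : unitInterval) (ht : IsWormholeLevel n t)
      (a : List Bool) (ha : a.length + 1 = n) (s s' : cantorSet)
      (hs : (s : ℝ) ∈ cantorCopy (a ++ [false])) (hs' : (s' : ℝ) = s + 2 / 3 ^ n) :
      WormholeRel (t, s) (t, s')

/-- The topological quotient of `I × K` by the equivalence relation generated by the
identifications. -/
abbrev LaaksoQuot : Type := Quot WormholeRel

/-- The Euclidean embedding of `I × K` into the plane. -/
def toPlane (z : IntervalCantor) : EuclideanSpace ℝ (Fin 2) := !₂[(z.1 : ℝ), (z.2 : ℝ)]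

/-- `d(x, y)` is the infimum of the one-dimensional Hausdorff measures (for the Euclidean metric
of `I × K ⊆ ℝ²`) of the sets `p ⊆ I × K` whose image `q(p)` in the quotient is the trace of a
continuous path from `x` to `y`. -/
def laaksoDist (x y : LaaksoQuot) : ℝ≥0∞ :=
  ⨅ (p : Set IntervalCantor) (_ : ∃ γ : Path x y, range γ = Quot.mk WormholeRel '' p),
    Measure.hausdorffMeasure 1 (toPlane '' p)

/-- Laakso space `F`: the quotient of `I × K`, equipped below with the distance `d`. -/
def Laakso : Type := LaaksoQuot

/-- The quotient map `q : I × K → F`. -/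
def laaksoMk (z : IntervalCantor) : Laakso := Quot.mk WormholeRel z

theorem laaksoDist_self (x : LaaksoQuot) : laaksoDist x x = 0 := by
  obtain ⟨z, rfl⟩ := Quot.exists_rep x
  refine le_antisymm (iInf₂_le_of_le {z} ⟨Path.refl _, ?_⟩ ?_) zero_le
  · simp
  · have := Measure.nullSingletonClass_hausdorff (EuclideanSpace ℝ (Fin 2)) one_pos
    rw [image_singleton, measure_singleton]

theorem laaksoDist_comm_le (x y : LaaksoQuot) : laaksoDist x y ≤ laaksoDist y x := by
  refine le_iInf₂ fun p hp => ?_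
  obtain ⟨γ, hγ⟩ := hp
  exact iInf₂_le_of_le p ⟨γ.symm, by rw [Path.symm_range, hγ]⟩ le_rfl

theorem laaksoDist_triangle (x y z : LaaksoQuot) :
    laaksoDist x z ≤ laaksoDist x y + laaksoDist y z := by
  unfold laaksoDist
  simp only [ENNReal.iInf_add, ENNReal.add_iInf]
  refine le_iInf₂ fun p' hp' => le_iInf₂ fun p hp => ?_
  obtain ⟨γ, hγ⟩ := hp
  obtain ⟨γ', hγ'⟩ := hp'
  exact iInf₂_le_of_le (p ∪ p')
    ⟨γ.trans γ', by rw [Path.trans_range, hγ, hγ', image_union]⟩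
    (by rw [image_union]; exact measure_union_le _ _)

/-- The distance `d` of Laakso space. (It is in fact finite and separates points.) -/
instance : PseudoEMetricSpace Laakso where
  edist := laaksoDist
  edist_self := laaksoDist_self
  edist_comm x y := le_antisymm (laaksoDist_comm_le x y) (laaksoDist_comm_le y x)
  edist_triangle := laaksoDist_triangle

/-- The Borel σ-algebra of `F`, taken for the quotient topology (which is the topology of `d`). -/
instance : MeasurableSpace Laakso := borel LaaksoQuot

theorem measurable_laaksoMk : Measurable laaksoMk := by
  borelize LaaksoQuot
  exact (continuous_quot_mk (r := WormholeRel)).measurable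

/-- The measure `μ_w = q_* (𝓗¹ × ν_w)` on `F`; here `𝓗¹` on `I = [0,1]` is Lebesgue measure. -/
def laaksoMeasure (w : unitInterval) : Measure Laakso :=
  ((volume : Measure unitInterval).prod (cantorMeasure w)).map laaksoMk

end

/-! A point of `F` is a height t with a binary address u, and at a wormhole level of order k + 1 the
digit `u k` may be changed freely. Every interval of length 2·3^-(k+1) in [0,1] contains such a
level, so one digit can be changed by a vertical excursion of that size.

Geometry: a single ascent through a triadic interval of length 3^-n can change all digits from place
n on (`edist_laaksoPoint_le_of_agree`). Conversely, a path of length less than r varies in height by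
less than r and changes digit k only if a level of order k + 1 is that close
(`of_edist_laaksoPoint_lt`). Hence for 2r ≤ 3^-n a ball of radius r meets at most two cylinders of
rank n, glued at a nearby level (`exists_twin_of_ball`), and doubling follows.

Analysis: along a fibre with constant address, increments of f are bounded by integrals of Lip[f].
To compare addresses u and v with n common digits, exchange the digits one at a time; digit k costs
the integral of Lip[f] over a window of size comparable to 3^-k on two intermediate fibres. The
intermediate addresses are splices of u and v, and a splice of two independent Bernoulli sequences
has the same Bernoulli law, whatever the weights. After averaging over u, v and the height, the cost
of digit k is a constant times 3^-k times the full integral, and the geometric series gives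
`column_poincare`. The two columns that cover a ball share the values of f at the gluing level, so
one constant serves both (`exists_setLIntegral_enorm_sub_le`). Doubling turns the integrals into
averages; only there do the weights matter, through a positive lower bound. -/

/-! ### Digits of points of the Cantor set -/

/-- The point of the Cantor set with binary address `u`. -/
noncomputable def cantorPoint (u : ℕ → Bool) : cantorSet := cantorSetHomeomorphNatToBool.symm u

theorem continuous_cantorPoint : Continuous cantorPoint :=
  cantorSetHomeomorphNatToBool.symm.continuous

theorem cantorPoint_surjective : Function.Surjective cantorPoint :=
  cantorSetHomeomorphNatToBool.symm.surjective

theorem cantorPoint_injective : Function.Injective cantorPoint :=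
  cantorSetHomeomorphNatToBool.symm.injective

theorem coe_cantorPoint (u : ℕ → Bool) :
    (cantorPoint u : ℝ) = Real.ofDigits (fun i => cond (u i) (2 : Fin 3) 0) := rfl

theorem coe_cantorPoint_succ (u : ℕ → Bool) :
    (cantorPoint u : ℝ) = (cantorPoint fun i => u (i + 1)) / 3 + cond (u 0) (2 / 3) 0 := by
  rw [coe_cantorPoint, Real.ofDigits_eq_sum_add_ofDigits _ 1, coe_cantorPoint]
  simp only [Finset.range_one, Finset.sum_singleton, Real.ofDigitsTerm]
  cases u 0 <;> simp <;> ring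

/-- Places are counted from 0, so wormholes of order k + 1 act on the digit in place k. -/
theorem coe_cantorPoint_update {u : ℕ → Bool} {k : ℕ} (hu : u k = false) :
    (cantorPoint (Function.update u k true) : ℝ) = cantorPoint u + 2 / 3 ^ (k + 1) := by
  induction k generalizing u with
  | zero =>
    rw [coe_cantorPoint_succ, coe_cantorPoint_succ u]
    simp [hu]
  | succ k ih =>
    rw [coe_cantorPoint_succ, coe_cantorPoint_succ u]
    have h : (fun i => Function.update u (k + 1) true (i + 1)) =
        Function.update (fun i => u (i + 1)) k true := by
      ext i
      simp [Function.update_apply]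
    rw [h, ih hu]
    simp
    ring

theorem mem_cantorCopy_iff (a : List Bool) (x : ℝ) :
    x ∈ cantorCopy a ↔ ∃ u : ℕ → Bool, (∀ i, (h : i < a.length) → u i = a[i]) ∧
      x = cantorPoint u := by
  induction a generalizing x with
  | nil =>
    simp only [cantorCopy, List.length_nil]
    constructor
    · intro hx
      obtain ⟨u, hu⟩ := cantorPoint_surjective ⟨x, hx⟩
      exact ⟨u, by simp, by rw [hu]⟩
    · rintro ⟨u, -, rfl⟩
      exact (cantorPoint u).2
  | cons b a ih =>
    simp only [cantorCopy, mem_image, ih]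
    constructor
    · rintro ⟨_, ⟨u, hu, rfl⟩, rfl⟩
      refine ⟨fun i => Nat.casesOn i b u, ?_, ?_⟩
      · rintro (_ | i) hi
        · rfl
        · simpa using hu i (by simpa using hi)
      · rw [coe_cantorPoint_succ (fun i => Nat.casesOn i b u)]
        rfl
    · rintro ⟨u, hu, rfl⟩
      refine ⟨_, ⟨fun i => u (i + 1), fun i hi => ?_, rfl⟩, ?_⟩
      · exact hu (i + 1) (by simpa using hi)
      · rw [coe_cantorPoint_succ u, show u 0 = b from hu 0 (by simp)]

/-! ### Wormhole levels -/

/-- The ternary digits of j are the m_i, and the last one is nonzero exactly when 3 does not divide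
j. Questions about levels become integer arithmetic. -/
theorem isWormholeLevel_iff (n : ℕ) (t : ℝ) :
    IsWormholeLevel n t ↔ 1 ≤ n ∧ ∃ j : ℕ, j < 3 ^ n ∧ ¬ 3 ∣ j ∧ t = j / 3 ^ n := by
  have sum_succ : ∀ (m : ℕ → Fin 3) (n : ℕ),
      ∑ i ∈ Finset.Icc 1 (n + 1), ((m i : ℕ) : ℝ) / 3 ^ i =
        ∑ i ∈ Finset.Icc 1 n, ((m i : ℕ) : ℝ) / 3 ^ i + (m (n + 1) : ℕ) / 3 ^ (n + 1) := by
    intro m n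
    rw [Finset.sum_Icc_succ_top (by omega)]
  have to_nat : ∀ (m : ℕ → Fin 3) (n : ℕ), ∃ j : ℕ, j < 3 ^ n ∧
      ∑ i ∈ Finset.Icc 1 n, ((m i : ℕ) : ℝ) / 3 ^ i = j / 3 ^ n := by
    intro m n
    induction n with
    | zero => exact ⟨0, by simp⟩
    | succ n ih =>
      obtain ⟨j, hj, h⟩ := ih
      refine ⟨3 * j + m (n + 1), ?_, ?_⟩
      · have := (m (n + 1)).2
        rw [pow_succ]
        omega
      · rw [sum_succ, h]
        push_cast
        field_simp
        ring
  have of_nat : ∀ n j : ℕ, j < 3 ^ n → ∃ m : ℕ → Fin 3,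
      ∑ i ∈ Finset.Icc 1 n, ((m i : ℕ) : ℝ) / 3 ^ i = j / 3 ^ n := by
    intro n
    induction n with
    | zero =>
      intro j hj
      refine ⟨0, ?_⟩
      have : j = 0 := by simpa using hj
      simp [this]
    | succ n ih =>
      intro j hj
      obtain ⟨m, hm⟩ := ih (j / 3) (by rw [pow_succ] at hj; omega)
      refine ⟨Function.update m (n + 1) ⟨j % 3, Nat.mod_lt _ (by norm_num)⟩, ?_⟩
      rw [sum_succ]
      have h1 : ∑ i ∈ Finset.Icc 1 n, (((Function.update m (n + 1)
          ⟨j % 3, Nat.mod_lt _ (by norm_num)⟩ : ℕ → Fin 3) i : ℕ) : ℝ) / 3 ^ i =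
          ∑ i ∈ Finset.Icc 1 n, ((m i : ℕ) : ℝ) / 3 ^ i := by
        refine Finset.sum_congr rfl fun i hi => ?_
        rw [Function.update_of_ne]
        have := (Finset.mem_Icc.1 hi).2
        omega
      rw [h1, hm]
      have h2 : (j : ℝ) = 3 * (j / 3 : ℕ) + (j % 3 : ℕ) := by exact_mod_cast (Nat.div_add_mod j 3).symm
      simp only [Function.update_self]
      rw [h2]
      field_simp
      simp only [pow_succ]
      ring_nf
  constructor
  · rintro ⟨hn, m, hm, rfl⟩
    refine ⟨hn, ?_⟩
    obtain ⟨n, rfl⟩ : ∃ k, n = k + 1 := ⟨n - 1, by omega⟩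
    obtain ⟨j, hj, h⟩ := to_nat m n
    have := (m (n + 1)).2
    have : 0 < (m (n + 1) : ℕ) := hm
    refine ⟨3 * j + m (n + 1), ?_, by omega, ?_⟩
    · rw [pow_succ]
      omega
    · rw [sum_succ, h]
      push_cast
      field_simp
      ring
  · rintro ⟨hn, j, hj, h3, rfl⟩
    refine ⟨hn, ?_⟩
    obtain ⟨m, hm⟩ := of_nat n j hj
    refine ⟨m, ?_, hm.symm⟩
    by_contra h0
    have h0 : m n = 0 := by simpa using h0
    obtain ⟨n, rfl⟩ : ∃ k, n = k + 1 := ⟨n - 1, by omega⟩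
    obtain ⟨j', hj', h⟩ := to_nat m n
    rw [sum_succ, h, h0] at hm
    apply h3
    refine ⟨j', ?_⟩
    field_simp at hm
    simp only [Fin.val_zero, Nat.cast_zero, pow_succ] at hm
    have : (3 * j' : ℝ) = j := by
      have h3n : (3 : ℝ) ^ n ≠ 0 := by positivity
      field_simp at hm
      linarith
    exact_mod_cast this.symm

theorem IsWormholeLevel.mem_Icc {n : ℕ} {t : ℝ} (h : IsWormholeLevel n t) : t ∈ Icc (0 : ℝ) 1 := by
  obtain ⟨-, j, hj, -, rfl⟩ := (isWormholeLevel_iff n t).1 h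
  refine ⟨by positivity, ?_⟩
  rw [div_le_one (by positivity)]
  exact_mod_cast hj.le

/-- A larger denominator 3^n with n > m would force the numerator to be a multiple of 3. -/
theorem IsWormholeLevel.order_le {m n : ℕ} {t : ℝ} (hm : IsWormholeLevel m t)
    (hn : IsWormholeLevel n t) : n ≤ m := by
  obtain ⟨-, i, -, hi, rfl⟩ := (isWormholeLevel_iff m t).1 hm
  obtain ⟨-, j, -, hj, h⟩ := (isWormholeLevel_iff n _).1 hn
  by_contra! hlt
  obtain ⟨k, rfl⟩ : ∃ k, n = m + k + 1 := ⟨n - m - 1, by omega⟩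
  apply hj
  refine ⟨i * 3 ^ k, ?_⟩
  have h3 : (3 : ℝ) ^ m ≠ 0 := by positivity
  rw [pow_succ, pow_add] at h
  field_simp at h
  have h' : i * 3 ^ k * 3 = j := by exact_mod_cast h
  rw [← h']
  ring

theorem IsWormholeLevel.order_unique {m n : ℕ} {t : ℝ} (hm : IsWormholeLevel m t)
    (hn : IsWormholeLevel n t) : m = n :=
  le_antisymm (hn.order_le hm) (hm.order_le hn)

/-- Two wormhole levels of order at most `n` that are less than `3⁻ⁿ` apart coincide. -/
theorem IsWormholeLevel.eq_of_abs_sub_lt {n k l : ℕ} {s t : ℝ} (hs : IsWormholeLevel k s)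
    (ht : IsWormholeLevel l t) (hk : k ≤ n) (hl : l ≤ n) (h : |s - t| < (3⁻¹ : ℝ) ^ n) : s = t := by
  obtain ⟨-, i, -, -, rfl⟩ := (isWormholeLevel_iff k s).1 hs
  obtain ⟨-, j, -, -, rfl⟩ := (isWormholeLevel_iff l t).1 ht
  have key : ∀ (i k : ℕ), k ≤ n → (i : ℝ) / 3 ^ k = ((i * 3 ^ (n - k) : ℤ) : ℝ) / 3 ^ n := by
    intro i k hk
    obtain ⟨m, rfl⟩ := Nat.exists_eq_add_of_le hk
    rw [Nat.add_sub_cancel_left]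
    push_cast
    rw [pow_add]
    field_simp
  rw [key i k hk, key j l hl] at h ⊢
  rw [← sub_div, abs_div, abs_of_pos (by positivity : (0 : ℝ) < 3 ^ n), inv_pow,
    div_lt_iff₀ (by positivity), inv_mul_cancel₀ (by positivity), ← Int.cast_sub] at h
  have : |(i * 3 ^ (n - k) - j * 3 ^ (n - l) : ℤ)| < 1 := by exact_mod_cast h
  rw [Int.abs_lt_one_iff, sub_eq_zero] at this
  rw [this]

/-- Every interval of length `2 · 3⁻ᵏ⁻¹` in `[0, 1]` contains a wormhole level of order `k + 1`. -/
theorem exists_isWormholeLevel_mem_Icc {k : ℕ} {x : ℝ} (h0 : 0 ≤ x)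
    (h1 : x + 2 * (3⁻¹ : ℝ) ^ (k + 1) ≤ 1) :
    ∃ t ∈ Icc x (x + 2 * (3⁻¹ : ℝ) ^ (k + 1)), IsWormholeLevel (k + 1) t := by
  have hp : (0 : ℝ) < 3 ^ (k + 1) := by positivity
  have hinv : (3⁻¹ : ℝ) ^ (k + 1) * 3 ^ (k + 1) = 1 := by
    rw [inv_pow, inv_mul_cancel₀ hp.ne']
  set j := ⌈x * 3 ^ (k + 1)⌉₊ with hj
  have hj1 : x * 3 ^ (k + 1) ≤ j := Nat.le_ceil _
  have hj2 : (j : ℝ) < x * 3 ^ (k + 1) + 1 := Nat.ceil_lt_add_one (by positivity)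
  have hx1 : x * 3 ^ (k + 1) + 2 ≤ 3 ^ (k + 1) := by nlinarith
  have key : ∀ i : ℕ, x * 3 ^ (k + 1) ≤ i → (i : ℝ) ≤ x * 3 ^ (k + 1) + 2 → ¬ 3 ∣ i →
      ∃ t ∈ Icc x (x + 2 * (3⁻¹ : ℝ) ^ (k + 1)), IsWormholeLevel (k + 1) t := by
    intro i hi1 hi2 hi3
    refine ⟨i / 3 ^ (k + 1), ⟨by rwa [le_div_iff₀ hp], ?_⟩,
      (isWormholeLevel_iff _ _).2 ⟨by omega, i, ?_, hi3, rfl⟩⟩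
    · rw [div_le_iff₀ hp]
      nlinarith
    · have : (i : ℝ) ≤ 3 ^ (k + 1) := hi2.trans hx1
      have h' : i ≤ 3 ^ (k + 1) := by exact_mod_cast this
      refine lt_of_le_of_ne h' ?_
      rintro rfl
      exact hi3 ⟨3 ^ k, by rw [pow_succ]; ring⟩
  -- In units of 3^-(k+1) the interval has length 2, so it contains both j and j + 1, and they are
  -- not both multiples of 3.
  by_cases h3 : 3 ∣ j
  · exact key (j + 1) (by push_cast; linarith) (by push_cast; linarith) (by omega)
  · exact key j hj1 (by linarith) h3

/-! ### Coordinates on Laakso space -/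

/-- The point of Laakso space with height `τ` (clamped to `[0, 1]`) and binary address `u`. -/
noncomputable def laaksoPoint (τ : ℝ) (u : ℕ → Bool) : Laakso :=
  laaksoMk (projIcc 0 1 zero_le_one τ, cantorPoint u)

theorem exists_laaksoPoint_eq (x : Laakso) :
    ∃ τ ∈ Icc (0 : ℝ) 1, ∃ u, laaksoPoint τ u = x := by
  obtain ⟨⟨t, s⟩, rfl⟩ := Quot.exists_rep x
  obtain ⟨u, rfl⟩ := cantorPoint_surjective s
  refine ⟨t, t.2, u, ?_⟩
  rw [laaksoPoint, projIcc_val]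
  rfl

theorem wormholeRel_cantorPoint {k : ℕ} {t : unitInterval} (ht : IsWormholeLevel (k + 1) t)
    {u : ℕ → Bool} (hu : u k = false) :
    WormholeRel (t, cantorPoint u) (t, cantorPoint (Function.update u k true)) := by
  refine WormholeRel.glue (k + 1) t ht (List.ofFn fun i : Fin k => u i) (by simp) _ _ ?_
    (coe_cantorPoint_update hu)
  rw [mem_cantorCopy_iff]
  refine ⟨u, fun i hi => ?_, rfl⟩
  simp only [List.length_append, List.length_ofFn, List.length_singleton] at hi
  rw [List.getElem_append]
  split_ifs with h
  · simp
  · have : i = k := by simp at h; omega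
    simp [this, hu]

/-- The gluing in the form used for constructing paths and for comparing values of functions on
different fibres. -/
theorem laaksoPoint_update {k : ℕ} {τ : ℝ} (ht : IsWormholeLevel (k + 1) τ) (u : ℕ → Bool)
    (b : Bool) : laaksoPoint τ (Function.update u k b) = laaksoPoint τ u := by
  have ht' : IsWormholeLevel (k + 1) (projIcc (0 : ℝ) 1 zero_le_one τ) := by
    rwa [projIcc_of_mem _ ht.mem_Icc]
  rcases h : u k with _ | _ <;> cases b
  · rw [← h, Function.update_eq_self]
  · exact (Quot.sound (wormholeRel_cantorPoint ht' h)).symm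
  · have := Quot.sound (wormholeRel_cantorPoint ht' (u := Function.update u k false) (by simp))
    rw [Function.update_idem] at this
    conv at this => rhs; rw [← h, Function.update_eq_self]
    exact this
  · rw [← h, Function.update_eq_self]

/-- Converse information about a generating pair; it lets the height, and each digit away from its
own levels, descend to the quotient. -/
theorem WormholeRel.exists_digit {x y : IntervalCantor} (h : WormholeRel x y) :
    x.1 = y.1 ∧ ∃ k, IsWormholeLevel (k + 1) x.1 ∧ ∀ u v : ℕ → Bool, cantorPoint u = x.2 →
      cantorPoint v = y.2 → ∀ i ≠ k, u i = v i := by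
  obtain ⟨n, t, ht, a, ha, s, s', hs, hs'⟩ := h
  subst ha
  refine ⟨rfl, a.length, ht, fun u v hu hv i hi => ?_⟩
  obtain ⟨u', hu', rfl'⟩ := (mem_cantorCopy_iff _ _).1 hs
  have h1 : u = u' := cantorPoint_injective (hu.trans (Subtype.ext rfl'))
  subst h1
  have h2 : u a.length = false := by
    rw [hu' a.length (by simp)]
    simp
  have h3 : v = Function.update u a.length true := by
    apply cantorPoint_injective
    apply Subtype.ext
    rw [hv, hs', coe_cantorPoint_update h2, rfl']
  rw [h3, Function.update_of_ne hi]

/-! ### Upper bounds for the distance -/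

/-- `laaksoPoint`, as a point of the topological quotient. -/
noncomputable def laaksoQuotPoint (τ : ℝ) (u : ℕ → Bool) : LaaksoQuot :=
  Quot.mk WormholeRel (projIcc 0 1 zero_le_one τ, cantorPoint u)

theorem continuous_laaksoQuotPoint :
    Continuous fun z : ℝ × (ℕ → Bool) => laaksoQuotPoint z.1 z.2 := by
  have h : Continuous fun z : ℝ × (ℕ → Bool) =>
      ((projIcc 0 1 zero_le_one z.1, cantorPoint z.2) : IntervalCantor) :=
    (continuous_projIcc.comp continuous_fst).prodMk (continuous_cantorPoint.comp continuous_snd)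
  exact (continuous_quot_mk (r := WormholeRel)).comp h

theorem lipschitzWith_horizontal (c : ℝ) :
    LipschitzWith 1 fun τ : ℝ => (!₂[τ, c] : EuclideanSpace ℝ (Fin 2)) := by
  refine LipschitzWith.of_dist_le_mul fun x y => ?_
  rw [EuclideanSpace.dist_eq]
  simp [Fin.sum_univ_two, Real.sqrt_sq_eq_abs, Real.dist_eq]

/-- The distance between the endpoints of a path whose lift to `I × K` is the graph over a height
interval of a measurable function with countably many values is at most the length of the
interval. -/
theorem edist_laaksoPoint_le_of_section {α β : ℝ} (hαβ : α ≤ β) (h0 : 0 ≤ α) (h1 : β ≤ 1)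
    {σ : ℝ → ℕ → Bool} (hσ : Measurable σ) (hc : (range σ).Countable)
    (hcont : Continuous fun τ => laaksoQuotPoint τ (σ τ)) :
    edist (laaksoPoint α (σ α)) (laaksoPoint β (σ β)) ≤ ENNReal.ofReal (β - α) := by
  set G : ℝ → LaaksoQuot := fun τ => laaksoQuotPoint τ (σ τ) with hG
  set P : ℝ → IntervalCantor := fun τ => (projIcc 0 1 zero_le_one τ, cantorPoint (σ τ)) with hP
  have hline : (AffineMap.lineMap α β : ℝ → ℝ) '' Icc 0 1 = Icc α β := by
    rw [← segment_eq_image_lineMap, segment_eq_Icc hαβ]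
  let γ : Path (G α) (G β) :=
    { toFun := fun θ => G (AffineMap.lineMap α β (θ : ℝ))
      continuous_toFun := hcont.comp
        ((AffineMap.lineMap_continuous (R := ℝ)).comp continuous_subtype_val)
      source' := by simp
      target' := by simp }
  have hγ : range γ = Quot.mk WormholeRel '' (P '' Icc α β) := by
    have h2 : (γ : unitInterval → LaaksoQuot) =
        G ∘ (AffineMap.lineMap α β : ℝ → ℝ) ∘ Subtype.val := rfl
    rw [h2, range_comp, range_comp, Subtype.range_coe, hline, image_image]
    rfl
  refine (iInf₂_le (P '' Icc α β) ⟨γ, hγ⟩).trans ?_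
  -- The lift splits into countably many slices of constant address. Each has measure at most that
  -- of its set of heights, and these sets are disjoint in [α, β].
  have hsub : toPlane '' (P '' Icc α β) ⊆ ⋃ v ∈ range σ,
      (fun τ : ℝ => (!₂[τ, (cantorPoint v : ℝ)] : EuclideanSpace ℝ (Fin 2))) ''
        (Icc α β ∩ σ ⁻¹' {v}) := by
    rintro _ ⟨_, ⟨τ, hτ, rfl⟩, rfl⟩
    refine mem_biUnion (mem_range_self τ) ⟨τ, ⟨hτ, rfl⟩, ?_⟩
    simp [toPlane, hP, projIcc_of_mem zero_le_one ⟨h0.trans hτ.1, hτ.2.trans h1⟩]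
  calc Measure.hausdorffMeasure 1 (toPlane '' (P '' Icc α β))
      ≤ ∑' v : range σ, Measure.hausdorffMeasure 1
          ((fun τ : ℝ => (!₂[τ, (cantorPoint v : ℝ)] : EuclideanSpace ℝ (Fin 2))) ''
            (Icc α β ∩ σ ⁻¹' {v.1})) := (measure_mono hsub).trans (measure_biUnion_le _ hc _)
    _ ≤ ∑' v : range σ, volume (Icc α β ∩ σ ⁻¹' {v.1}) := by
        refine ENNReal.tsum_le_tsum fun v => ?_
        refine ((lipschitzWith_horizontal _).hausdorffMeasure_image_le zero_le_one _).trans ?_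
        rw [hausdorffMeasure_real]
        simp
    _ = volume (⋃ v ∈ range σ, Icc α β ∩ σ ⁻¹' {v}) := by
        rw [measure_biUnion hc]
        · intro v _ w _ hvw
          refine Set.disjoint_left.2 fun τ h h' => hvw ?_
          exact h.2.symm.trans h'.2
        · exact fun v _ => measurableSet_Icc.inter (hσ (measurableSet_singleton v))
    _ ≤ volume (Icc α β) := measure_mono (iUnion₂_subset fun v _ => inter_subset_left)
    _ = ENNReal.ofReal (β - α) := Real.volume_Icc

theorem edist_laaksoPoint_le (τ τ' : ℝ) (u : ℕ → Bool) :
    edist (laaksoPoint τ u) (laaksoPoint τ' u) ≤ ENNReal.ofReal |τ - τ'| := by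
  have key : ∀ a b : ℝ, a ≤ b → 0 ≤ a → b ≤ 1 →
      edist (laaksoPoint a u) (laaksoPoint b u) ≤ ENNReal.ofReal (b - a) := by
    intro a b hab h0 h1
    refine edist_laaksoPoint_le_of_section (σ := fun _ => u) hab h0 h1 measurable_const ?_ ?_
    · exact (countable_singleton u).mono (by rintro _ ⟨_, rfl⟩; rfl)
    · exact continuous_laaksoQuotPoint.comp (continuous_id.prodMk continuous_const)
  have hproj : ∀ a, laaksoPoint a u = laaksoPoint (projIcc (0 : ℝ) 1 zero_le_one a) u := by
    intro a
    simp [laaksoPoint]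
  wlog h : τ ≤ τ' generalizing τ τ'
  · rw [edist_comm, abs_sub_comm]
    exact this _ _ (le_of_not_ge h)
  rw [hproj τ, hproj τ']
  refine (key _ _ (monotone_projIcc _ h) (projIcc _ _ _ τ).2.1 (projIcc _ _ _ τ').2.2).trans ?_
  refine ENNReal.ofReal_le_ofReal ?_
  have := abs_projIcc_sub_projIcc (c := τ) (d := τ') (zero_le_one (α := ℝ))
  rw [abs_sub_comm] at this
  exact (le_abs_self _).trans this

/-- Points at the same height whose addresses agree up to place `n` are at distance at most
`2 · 3⁻ⁿ`. -/
theorem edist_laaksoPoint_le_of_agree {τ : ℝ} (hτ : τ ∈ Icc (0 : ℝ) 1) {n : ℕ} {u v : ℕ → Bool}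
    (huv : ∀ i < n, u i = v i) :
    edist (laaksoPoint τ u) (laaksoPoint τ v) ≤ ENNReal.ofReal (2 * (3⁻¹ : ℝ) ^ n) := by
  have hp : (0 : ℝ) < 3 ^ n := by positivity
  have hq : (0 : ℝ) < 3⁻¹ ^ n := by positivity
  -- A triadic interval of rank n containing τ. At τ = 1 the floor would overshoot, so the last
  -- interval is taken.
  obtain ⟨j, hj1, hj2, hj3⟩ : ∃ j : ℕ, (j : ℝ) / 3 ^ n ≤ τ ∧ τ ≤ j / 3 ^ n + 3⁻¹ ^ n ∧
      j + 1 ≤ 3 ^ n := by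
    rcases hτ.2.lt_or_eq with h | h
    · have hτ3 : τ * 3 ^ n < 3 ^ n := by nlinarith
      have h0 : 0 ≤ τ * 3 ^ n := mul_nonneg hτ.1 hp.le
      refine ⟨⌊τ * 3 ^ n⌋₊, ?_, ?_, ?_⟩
      · rw [div_le_iff₀ hp]
        exact Nat.floor_le h0
      · rw [inv_pow, ← one_div, ← add_div, le_div_iff₀ hp]
        exact (Nat.lt_floor_add_one _).le
      · have : (⌊τ * 3 ^ n⌋₊ : ℝ) < 3 ^ n := (Nat.floor_le h0).trans_lt hτ3
        exact_mod_cast this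
    · have h3 : 1 ≤ 3 ^ n := Nat.one_le_pow _ _ (by norm_num)
      refine ⟨3 ^ n - 1, ?_, ?_, by omega⟩
      · rw [h, div_le_one hp]
        push_cast [h3]
        linarith
      · rw [h, inv_pow, ← one_div, ← add_div, le_div_iff₀ hp]
        push_cast [h3]
        linarith
  set α : ℝ := j / 3 ^ n with hα
  -- For k ≥ n this is α + 3^-(n+1) + ... + 3^-(k+1): its last ternary digit is 1, so it has order k
  -- + 1, and it increases to the midpoint of the triadic interval. Digit k is switched at height T
  -- k.
  set T : ℕ → ℝ := fun k => α + ((3⁻¹ : ℝ) ^ n - 3⁻¹ ^ (k + 1)) / 2 with hT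
  have hTmono : StrictMono T := by
    intro a b hab
    have : (3⁻¹ : ℝ) ^ (b + 1) < 3⁻¹ ^ (a + 1) :=
      pow_lt_pow_right_of_lt_one₀ (by norm_num) (by norm_num) (by omega)
    simp only [hT]
    linarith
  have hTlevel : ∀ k, n ≤ k → IsWormholeLevel (k + 1) (T k) := by
    intro k hk
    obtain ⟨m, rfl⟩ := Nat.exists_eq_add_of_le hk
    rw [isWormholeLevel_iff]
    have hodd : ∃ c : ℕ, 2 * (3 * c + 1) + 1 = 3 ^ (m + 1) := by
      clear * -
      induction m with
      | zero => exact ⟨0, by norm_num⟩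
      | succ m ih =>
        obtain ⟨c, hc⟩ := ih
        exact ⟨3 * c + 1, by rw [pow_succ, ← hc]; ring⟩
    obtain ⟨c, hc⟩ := hodd
    refine ⟨by omega, j * 3 ^ (m + 1) + (3 * c + 1), ?_, ?_, ?_⟩
    · calc j * 3 ^ (m + 1) + (3 * c + 1) < (j + 1) * 3 ^ (m + 1) := by
            rw [add_mul, ← hc]
            omega
        _ ≤ 3 ^ n * 3 ^ (m + 1) := Nat.mul_le_mul_right _ hj3
        _ = 3 ^ (n + m + 1) := by rw [← pow_add, add_assoc]
    · rw [pow_succ, ← mul_assoc]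
      omega
    · have hc' : (2 * (3 * c + 1) + 1 : ℝ) = 3 ^ (m + 1) := by exact_mod_cast hc
      simp only [hT, hα]
      rw [add_assoc, pow_add, pow_add (3 : ℝ), inv_pow (3 : ℝ) (m + 1), inv_pow]
      push_cast
      rw [← hc']
      field_simp
      ring
  have hTα : ∀ k, n ≤ k → α < T k := by
    intro k hk
    have : (3⁻¹ : ℝ) ^ (k + 1) < 3⁻¹ ^ n :=
      pow_lt_pow_right_of_lt_one₀ (by norm_num) (by norm_num) (by omega)
    simp only [hT]
    linarith
  have hTβ : ∀ k, T k < α + 3⁻¹ ^ n := by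
    intro k
    have : (0 : ℝ) < 3⁻¹ ^ (k + 1) := by positivity
    simp only [hT]
    linarith
  -- σ is left continuous and σ' is right continuous. They differ only at heights T k, in digit k,
  -- where the quotient identifies them; hence the path in the quotient is continuous.
  set σ : ℝ → ℕ → Bool := fun θ k => if θ ≤ T k then u k else v k with hσ
  set σ' : ℝ → ℕ → Bool := fun θ k => if θ < T k then u k else v k with hσ'
  have hσσ' : ∀ θ, laaksoPoint θ (σ θ) = laaksoPoint θ (σ' θ) := by
    intro θ
    by_cases hθ : ∃ k, n ≤ k ∧ T k = θ
    · obtain ⟨k, hk, rfl⟩ := hθ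
      have : σ (T k) = Function.update (σ' (T k)) k (u k) := by
        ext i
        rcases eq_or_ne i k with rfl | hi
        · simp [hσ]
        · rw [Function.update_of_ne hi]
          simp only [hσ, hσ']
          have hne : T k ≠ T i := fun h => hi (hTmono.injective h).symm
          simp only [le_iff_lt_or_eq, hne, or_false]
      rw [this, laaksoPoint_update (hTlevel k hk)]
    · have : σ θ = σ' θ := by
        ext i
        by_cases hi : i < n
        · simp [hσ, hσ', huv i hi]
        · have hne : θ ≠ T i := fun h => hθ ⟨i, by omega, h.symm⟩
          simp only [hσ, hσ', le_iff_lt_or_eq, hne, or_false]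
      rw [this]
  have hmeas : Measurable σ := by
    refine measurable_pi_lambda _ fun k => ?_
    exact Measurable.ite measurableSet_Iic measurable_const measurable_const
  have hcount : (range σ).Countable := by
    -- As T increases, σ θ is determined by the first k with θ ≤ T k, if there is one.
    have hsub : range σ ⊆ insert v (range fun j : ℕ => fun k => if j ≤ k then u k else v k) := by
      rintro _ ⟨θ, rfl⟩
      by_cases hθ : ∃ k, θ ≤ T k
      · right
        classical
        refine ⟨Nat.find hθ, ?_⟩
        ext k
        simp only [hσ]
        have : Nat.find hθ ≤ k ↔ θ ≤ T k :=
          ⟨fun h => (Nat.find_spec hθ).trans (hTmono.monotone h), fun h => Nat.find_min' hθ h⟩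
        simp only [this]
      · left
        push Not at hθ
        ext k
        simp [hσ, (hθ k).not_ge]
    exact ((countable_range _).insert v).mono hsub
  have hcont : Continuous fun θ => laaksoQuotPoint θ (σ θ) := by
    rw [continuous_iff_continuousAt]
    intro θ
    rw [continuousAt_iff_continuous_left_right]
    constructor
    · have h : ContinuousWithinAt σ (Iic θ) θ := by
        refine continuousWithinAt_pi.2 fun k => ?_
        refine (continuousWithinAt_const (b := σ θ k)).congr_of_eventuallyEq ?_ rfl
        by_cases hk : θ ≤ T k
        · filter_upwards [self_mem_nhdsWithin] with x hx
          simp [hσ, hk, le_trans hx hk]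
        · filter_upwards [mem_nhdsWithin_of_mem_nhds (Ioi_mem_nhds (not_le.1 hk))] with x hx
          simp [hσ, hk, not_le.2 (mem_Ioi.1 hx)]
      exact continuous_laaksoQuotPoint.continuousAt.comp_continuousWithinAt
        (continuousWithinAt_id.prodMk h)
    · have h : ContinuousWithinAt σ' (Ici θ) θ := by
        refine continuousWithinAt_pi.2 fun k => ?_
        refine (continuousWithinAt_const (b := σ' θ k)).congr_of_eventuallyEq ?_ rfl
        by_cases hk : θ < T k
        · filter_upwards [mem_nhdsWithin_of_mem_nhds (Iio_mem_nhds hk)] with x hx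
          simp [hσ', hk, mem_Iio.1 hx]
        · filter_upwards [self_mem_nhdsWithin] with x hx
          simp [hσ', hk, not_lt.2 ((not_lt.1 hk).trans hx)]
      have h2 : (fun θ => laaksoQuotPoint θ (σ θ)) =
          fun θ => laaksoQuotPoint θ (σ' θ) := funext hσσ'
      rw [h2]
      exact continuous_laaksoQuotPoint.continuousAt.comp_continuousWithinAt
        (continuousWithinAt_id.prodMk h)
  have hα0 : 0 ≤ α := by positivity
  have hβ1 : α + 3⁻¹ ^ n ≤ 1 := by
    rw [hα, inv_pow, ← one_div, ← add_div, div_le_one hp]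
    exact_mod_cast hj3
  have hσα : σ α = u := by
    ext k
    by_cases hk : k < n
    · simp [hσ, huv k hk]
    · simp [hσ, (hTα k (by omega)).le]
  have hσβ : σ (α + 3⁻¹ ^ n) = v := by
    ext k
    simp only [hσ, (hTβ k).not_ge, if_false]
  have hmain := edist_laaksoPoint_le_of_section (by linarith) hα0 hβ1 hmeas hcount hcont
  rw [hσα, hσβ] at hmain
  -- Descend along u to the bottom of the triadic interval, ascend to its top while switching, then
  -- descend along v to τ.
  calc edist (laaksoPoint τ u) (laaksoPoint τ v)
      ≤ edist (laaksoPoint τ u) (laaksoPoint α u) +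
          edist (laaksoPoint α u) (laaksoPoint (α + 3⁻¹ ^ n) v) +
          edist (laaksoPoint (α + 3⁻¹ ^ n) v) (laaksoPoint τ v) := edist_triangle4 _ _ _ _
    _ ≤ ENNReal.ofReal (τ - α) + ENNReal.ofReal (α + 3⁻¹ ^ n - α) +
          ENNReal.ofReal (α + 3⁻¹ ^ n - τ) := by
        refine add_le_add (add_le_add ?_ hmain) ?_
        · exact (edist_laaksoPoint_le _ _ _).trans_eq (by rw [abs_of_nonneg (by linarith)])
        · exact (edist_laaksoPoint_le _ _ _).trans_eq (by rw [abs_of_nonneg (by linarith)])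
    _ = ENNReal.ofReal (2 * 3⁻¹ ^ n) := by
        rw [← ENNReal.ofReal_add (by linarith) (by linarith),
          ← ENNReal.ofReal_add (by linarith) (by linarith)]
        congr 1
        ring

/-- Here the target carries the topology of d, so the two upper bounds for the distance are needed;
for the quotient topology continuity is immediate. -/
theorem continuous_laaksoPoint : Continuous fun z : ℝ × (ℕ → Bool) => laaksoPoint z.1 z.2 := by
  rw [continuous_iff_continuousAt]
  rintro ⟨τ, u⟩
  rw [ContinuousAt, EMetric.tendsto_nhds]
  intro ε hε
  have hlim1 : Tendsto (fun z : ℝ × (ℕ → Bool) => ENNReal.ofReal |z.1 - τ|) (𝓝 (τ, u)) (𝓝 0) := by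
    have : Continuous fun z : ℝ × (ℕ → Bool) => ENNReal.ofReal |z.1 - τ| :=
      ENNReal.continuous_ofReal.comp (by fun_prop)
    simpa using this.tendsto (τ, u)
  have hlim2 : Tendsto (fun n : ℕ => ENNReal.ofReal (2 * (3⁻¹ : ℝ) ^ n)) atTop (𝓝 0) := by
    have h := (tendsto_pow_atTop_nhds_zero_of_lt_one (r := (3⁻¹ : ℝ)) (by norm_num)
      (by norm_num)).const_mul 2
    simpa using ENNReal.tendsto_ofReal h
  have hε2 : 0 < ε / 2 := ENNReal.half_pos hε.ne'
  obtain ⟨n, hn⟩ := (hlim2.eventually (gt_mem_nhds hε2)).exists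
  have hagree : ∀ᶠ z : ℝ × (ℕ → Bool) in 𝓝 (τ, u), ∀ i < n, z.2 i = u i := by
    have : ∀ i ∈ Finset.range n, ∀ᶠ z : ℝ × (ℕ → Bool) in 𝓝 (τ, u), z.2 i = u i := by
      intro i _
      have hc : Continuous fun z : ℝ × (ℕ → Bool) => z.2 i := by fun_prop
      exact (hc.tendsto (τ, u)).eventually_mem (by simp : {u i} ∈ 𝓝 (u i))
    simpa using (Finset.eventually_all (Finset.range n)).2 this
  filter_upwards [hagree, hlim1.eventually (gt_mem_nhds hε2)] with z hz1 hz2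
  have hproj : ∀ w, laaksoPoint τ w = laaksoPoint (projIcc (0 : ℝ) 1 zero_le_one τ) w := by
    intro w
    simp [laaksoPoint]
  calc edist (laaksoPoint z.1 z.2) (laaksoPoint τ u)
      ≤ edist (laaksoPoint z.1 z.2) (laaksoPoint τ z.2) +
          edist (laaksoPoint τ z.2) (laaksoPoint τ u) := edist_triangle _ _ _
    _ ≤ ENNReal.ofReal |z.1 - τ| + ENNReal.ofReal (2 * 3⁻¹ ^ n) := by
        refine add_le_add (edist_laaksoPoint_le _ _ _) ?_
        rw [hproj z.2, hproj u]
        exact edist_laaksoPoint_le_of_agree (projIcc (0 : ℝ) 1 zero_le_one τ).2 hz1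
    _ < ε / 2 + ε / 2 := ENNReal.add_lt_add hz2 hn
    _ = ε := ENNReal.add_halves ε

theorem continuous_laaksoMk : Continuous laaksoMk := by
  have : laaksoMk = (fun z : ℝ × (ℕ → Bool) => laaksoPoint z.1 z.2) ∘
      fun z : IntervalCantor => ((z.1 : ℝ), cantorSetHomeomorphNatToBool z.2) := by
    ext z
    simp [laaksoPoint, cantorPoint]
  rw [this]
  exact continuous_laaksoPoint.comp ((continuous_subtype_val.comp continuous_fst).prodMk
    (cantorSetHomeomorphNatToBool.continuous.comp continuous_snd))

/-- The σ-algebra comes from the quotient topology, and continuity of `laaksoMk` makes every d-open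
set open there. -/
instance : OpensMeasurableSpace Laakso where
  borel_le := by
    refine MeasurableSpace.generateFrom_le fun s hs => ?_
    refine MeasurableSpace.measurableSet_generateFrom ?_
    change IsOpen (Quot.mk WormholeRel ⁻¹' s)
    exact hs.preimage continuous_laaksoMk

/-! ### Lower bounds for the distance -/

/-- The height of a point of Laakso space. -/
noncomputable def laaksoHeight : LaaksoQuot → ℝ :=
  Quot.lift (fun z => (z.1 : ℝ)) fun _ _ h => congrArg Subtype.val h.exists_digit.1

theorem continuous_laaksoHeight : Continuous laaksoHeight :=
  continuous_quot_lift _ (continuous_subtype_val.comp continuous_fst)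

theorem laaksoHeight_laaksoPoint {τ : ℝ} (hτ : τ ∈ Icc (0 : ℝ) 1) (u : ℕ → Bool) :
    laaksoHeight (laaksoQuotPoint τ u) = τ := by
  simp [laaksoHeight, laaksoQuotPoint, projIcc_of_mem _ hτ]

/-- The set of points whose height is not a wormhole level of order `k + 1` and whose digit in
place `k` is `b`. -/
def laaksoDigitSet (k : ℕ) (b : Bool) : Set LaaksoQuot :=
  {x | Quot.lift (fun z : IntervalCantor => ¬ IsWormholeLevel (k + 1) z.1 ∧
      cantorSetHomeomorphNatToBool z.2 k = b) (by
    intro z z' h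
    obtain ⟨h1, i, hi, h2⟩ := h.exists_digit
    have h3 := h2 (cantorSetHomeomorphNatToBool z.2) (cantorSetHomeomorphNatToBool z'.2)
      (by simp [cantorPoint]) (by simp [cantorPoint]) k
    rw [← h1]
    by_cases hk : k = i
    · simp [hk, hi]
    · rw [h3 hk]) x}

theorem finite_isWormholeLevel (n : ℕ) : {t : ℝ | IsWormholeLevel n t}.Finite := by
  refine ((Finset.range (3 ^ n)).finite_toSet.image fun j : ℕ => (j : ℝ) / 3 ^ n).subset ?_
  rintro t ht
  obtain ⟨-, j, hj, -, rfl⟩ := (isWormholeLevel_iff n t).1 ht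
  exact ⟨j, by simpa using hj, rfl⟩

theorem isOpen_laaksoDigitSet (k : ℕ) (b : Bool) : IsOpen (laaksoDigitSet k b) := by
  change IsOpen {z : IntervalCantor | ¬ IsWormholeLevel (k + 1) z.1 ∧
      cantorSetHomeomorphNatToBool z.2 k = b}
  refine IsOpen.inter ?_ ?_
  · exact ((finite_isWormholeLevel (k + 1)).isClosed.preimage
      (continuous_subtype_val.comp continuous_fst)).isOpen_compl
  · have hc : Continuous fun z : IntervalCantor => cantorSetHomeomorphNatToBool z.2 k :=
      (continuous_apply k).comp (cantorSetHomeomorphNatToBool.continuous.comp continuous_snd)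
    exact (isOpen_discrete {b}).preimage hc

theorem laaksoQuotPoint_mem_laaksoDigitSet {τ : ℝ} (hτ : τ ∈ Icc (0 : ℝ) 1) {u : ℕ → Bool} {k : ℕ}
    {b : Bool} :
    laaksoQuotPoint τ u ∈ laaksoDigitSet k b ↔ ¬ IsWormholeLevel (k + 1) τ ∧ u k = b := by
  simp [laaksoDigitSet, laaksoQuotPoint, projIcc_of_mem _ hτ, cantorPoint]

theorem exists_laaksoQuotPoint_eq (x : LaaksoQuot) :
    ∃ τ ∈ Icc (0 : ℝ) 1, ∃ u, laaksoQuotPoint τ u = x :=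
  exists_laaksoPoint_eq x

/-- Projection to the height is 1-Lipschitz. This bounds the height range of a path by the cost of
its lift. -/
theorem volume_fst_image_le (p : Set IntervalCantor) :
    volume ((fun z : IntervalCantor => (z.1 : ℝ)) '' p) ≤
      Measure.hausdorffMeasure 1 (toPlane '' p) := by
  have hL : LipschitzWith 1 fun w : EuclideanSpace ℝ (Fin 2) => w 0 := by
    refine LipschitzWith.of_dist_le_mul fun x y => ?_
    rw [EuclideanSpace.dist_eq, NNReal.coe_one, one_mul]
    refine Real.le_sqrt_of_sq_le ?_
    rw [Fin.sum_univ_two]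
    linarith [sq_nonneg (dist (x 1) (y 1))]
  have h := hL.hausdorffMeasure_image_le zero_le_one (toPlane '' p)
  rw [hausdorffMeasure_real, image_image] at h
  simpa [toPlane] using h

/-- A point at distance less than `r` has height within `r`, and each of its digits is unchanged
unless there is a wormhole level of the corresponding order within `r`. -/
theorem of_edist_laaksoPoint_lt {t t' r : ℝ} (ht : t ∈ Icc (0 : ℝ) 1) (ht' : t' ∈ Icc (0 : ℝ) 1)
    {u u' : ℕ → Bool} (h : edist (laaksoPoint t u) (laaksoPoint t' u') < ENNReal.ofReal r) :
    |t - t'| < r ∧ ∀ k, u k = u' k ∨ ∃ l, IsWormholeLevel (k + 1) l ∧ |t - l| < r := by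
  obtain ⟨p, hp⟩ := iInf_lt_iff.1 (show laaksoDist (laaksoQuotPoint t u) (laaksoQuotPoint t' u') <
    ENNReal.ofReal r from h)
  obtain ⟨⟨γ, hγ⟩, hp⟩ := iInf_lt_iff.1 hp
  have hpre : IsPreconnected (range γ) := isPreconnected_range γ.continuous
  have hheight : laaksoHeight '' range γ = (fun z : IntervalCantor => (z.1 : ℝ)) '' p := by
    rw [hγ, image_image]
    rfl
  -- The heights visited form an interval, whose length is at most the measure of the lift, hence
  -- less than r.
  have hord : OrdConnected (laaksoHeight '' range γ) :=
    (hpre.image _ continuous_laaksoHeight.continuousOn).ordConnected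
  have hclose : ∀ x ∈ range γ, ∀ y ∈ range γ, |laaksoHeight x - laaksoHeight y| < r := by
    intro x hx y hy
    have h1 := measure_mono (μ := volume)
      (hord.uIcc_subset (mem_image_of_mem laaksoHeight hy) (mem_image_of_mem laaksoHeight hx))
    rw [Real.volume_interval, hheight] at h1
    exact (ENNReal.ofReal_lt_ofReal_iff_of_nonneg (abs_nonneg _)).1
      ((h1.trans (volume_fst_image_le p)).trans_lt hp)
  have hs : laaksoQuotPoint t u ∈ range γ := ⟨0, γ.source⟩
  have he : laaksoQuotPoint t' u' ∈ range γ := ⟨1, γ.target⟩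
  constructor
  · have := hclose _ hs _ he
    rwa [laaksoHeight_laaksoPoint ht, laaksoHeight_laaksoPoint ht'] at this
  · intro k
    by_contra! hcon
    obtain ⟨hne, hlev⟩ := hcon
    -- If no level of order k + 1 is within r, the path avoids all of them, and the two open digit
    -- sets for place k would disconnect it.
    have hno : ∀ τ ∈ Icc (0 : ℝ) 1, ∀ w, laaksoQuotPoint τ w ∈ range γ →
        ¬ IsWormholeLevel (k + 1) τ := by
      intro τ hτ w hw hl
      have h1 := hclose _ hs _ hw
      rw [laaksoHeight_laaksoPoint ht, laaksoHeight_laaksoPoint hτ] at h1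
      exact (hlev τ hl).not_gt h1
    obtain ⟨x, -, hx1, hx2⟩ := hpre _ _ (isOpen_laaksoDigitSet k (u k))
      (isOpen_laaksoDigitSet k (u' k)) (by
        intro x hx
        obtain ⟨τ, hτ, w, rfl⟩ := exists_laaksoQuotPoint_eq x
        simp only [mem_union, laaksoQuotPoint_mem_laaksoDigitSet hτ]
        have := hno τ hτ w hx
        have h3 : w k = u k ∨ w k = u' k := by
          revert hne
          cases w k <;> cases u k <;> cases u' k <;> simp
        tauto)
      ⟨_, hs, (laaksoQuotPoint_mem_laaksoDigitSet ht).2 ⟨hno t ht u hs, rfl⟩⟩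
      ⟨_, he, (laaksoQuotPoint_mem_laaksoDigitSet ht').2 ⟨hno t' ht' u' he, rfl⟩⟩
    obtain ⟨τ, hτ, w, rfl⟩ := exists_laaksoQuotPoint_eq x
    rw [laaksoQuotPoint_mem_laaksoDigitSet hτ] at hx1 hx2
    exact hne (hx1.2.symm.trans hx2.2)

/-- At a scale `3⁻ⁿ ≥ 2 r` (or at scale `1`), a ball of radius `r` meets at most two cylinders of
rank `n`, and if there are two, they are joined by wormholes at a level within `r`. -/
theorem exists_twin_of_ball {n : ℕ} {t r : ℝ} (ht : t ∈ Icc (0 : ℝ) 1) (hr : 0 < r)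
    (hn : n = 0 ∨ 2 * r ≤ (3⁻¹ : ℝ) ^ n) (u : ℕ → Bool) :
    ∃ l ∈ Icc (0 : ℝ) 1, |t - l| < r ∧ ∃ k b, (k < n → IsWormholeLevel (k + 1) l) ∧
      ∀ t' ∈ Icc (0 : ℝ) 1, ∀ u' : ℕ → Bool,
        edist (laaksoPoint t u) (laaksoPoint t' u') < ENNReal.ofReal r →
        (∀ i < n, u i = u' i) ∨ ∀ i < n, Function.update u k b i = u' i := by
  by_cases hex : ∃ k < n, ∃ l, IsWormholeLevel (k + 1) l ∧ |t - l| < r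
  · obtain ⟨k, hk, l, hl, htl⟩ := hex
    refine ⟨l, hl.mem_Icc, htl, k, !u k, fun _ => hl, fun t' ht' u' h => ?_⟩
    have hsame : ∀ i < n, i ≠ k → u i = u' i := by
      intro i hi hik
      refine ((of_edist_laaksoPoint_lt ht ht' h).2 i).resolve_right ?_
      rintro ⟨l', hl', htl'⟩
      -- Both levels are within r of t, so they are less than 2r ≤ 3^-n apart; coinciding levels
      -- have the same order, which gives i = k.
      have h1 : l = l' := by
        refine hl.eq_of_abs_sub_lt hl' (show k + 1 ≤ n from hk) (show i + 1 ≤ n from hi) ?_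
        rcases hn with rfl | hn
        · omega
        · refine lt_of_lt_of_le ?_ hn
          rw [abs_lt] at *
          constructor <;> linarith [htl.1, htl.2, htl'.1, htl'.2]
      have := hl.order_unique (h1 ▸ hl')
      omega
    by_cases hku : u k = u' k
    · left
      intro i hi
      by_cases hik : i = k
      · rw [hik, hku]
      · exact hsame i hi hik
    · right
      intro i hi
      by_cases hik : i = k
      · subst hik
        rw [Function.update_self]
        revert hku
        cases u i <;> cases u' i <;> simp
      · rw [Function.update_of_ne hik]
        exact hsame i hi hik
  -- A trivial twin: k = n makes the gluing clause vacuous, and overwriting `u n` by itself changes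
  -- nothing.
  · refine ⟨t, ht, by simpa using hr, n, u n, fun h => absurd h (lt_irrefl _),
      fun t' ht' u' h => Or.inl fun i hi => ?_⟩
    refine ((of_edist_laaksoPoint_lt ht ht' h).2 i).resolve_right ?_
    rintro ⟨l, hl⟩
    exact hex ⟨i, hi, l, hl⟩

/-! ### The pointwise Lipschitz constant -/

/-- Prepares measurability: a countable infimum, with y ≠ x replaced by the condition of positive
distance, which is open in x. Points at distance 0 contribute 0 / 0 = 0, since f agrees there. -/
theorem pointwiseLip_eq_iInf_iSup {X : Type*} [PseudoEMetricSpace X] {f : X → ℝ} {L : ℝ≥0}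
    (hf : LipschitzWith L f) (x : X) :
    pointwiseLip f x = ⨅ n : ℕ, ⨆ y : X, ⨆ _ : 0 < edist y x ∧ edist y x < (n + 1 : ℝ≥0∞)⁻¹,
      edist (f y) (f x) / edist y x := by
  have hb : (𝓝[≠] x).HasBasis (fun _ : ℕ => True)
      fun n => Metric.eball x (n + 1 : ℝ≥0∞)⁻¹ ∩ {x}ᶜ := by
    refine nhdsWithin_hasBasis ?_ _
    refine Metric.nhds_basis_eball.to_hasBasis (fun ε hε => ?_) fun n _ =>
      ⟨_, ENNReal.inv_pos.2 (by finiteness), subset_rfl⟩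
    obtain ⟨n, hn⟩ := ENNReal.exists_inv_nat_lt hε.ne'
    refine ⟨n, trivial, Metric.eball_subset_eball (le_trans ?_ hn.le)⟩
    exact ENNReal.inv_le_inv.2 le_self_add
  rw [pointwiseLip, hb.limsup_eq_iInf_iSup]
  simp only [iInf_true]
  refine iInf_congr fun n => le_antisymm ?_ ?_
  · refine iSup₂_le fun y hy => ?_
    rcases eq_or_ne (edist y x) 0 with h0 | h0
    · have : edist (f y) (f x) = 0 := by
        have := hf y x
        rwa [h0, mul_zero, nonpos_iff_eq_zero] at this
      simp [this]
    · exact le_iSup₂_of_le y ⟨pos_iff_ne_zero.2 h0, hy.1⟩ le_rfl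
  · refine iSup₂_le fun y hy => ?_
    refine le_iSup₂_of_le y ⟨hy.2, ?_⟩ le_rfl
    rintro rfl
    simp at hy

/-- For each scale the superlevel sets of the supremum are unions of open sets, so the supremum over
uncountably many y causes no difficulty. -/
theorem measurable_pointwiseLip {X : Type*} [PseudoEMetricSpace X] [MeasurableSpace X]
    [OpensMeasurableSpace X] {f : X → ℝ} {L : ℝ≥0} (hf : LipschitzWith L f) :
    Measurable (pointwiseLip f) := by
  rw [funext (pointwiseLip_eq_iInf_iSup hf)]
  refine Measurable.iInf fun n => measurable_of_Ioi fun c => IsOpen.measurableSet ?_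
  rcases eq_or_ne c ⊤ with rfl | hc
  · simp
  have : (fun x => ⨆ y : X, ⨆ _ : 0 < edist y x ∧ edist y x < (n + 1 : ℝ≥0∞)⁻¹,
      edist (f y) (f x) / edist y x) ⁻¹' Ioi c =
      ⋃ y : X, {x | 0 < edist y x} ∩ {x | edist y x < (n + 1 : ℝ≥0∞)⁻¹} ∩
        {x | c * edist y x < edist (f y) (f x)} := by
    ext x
    simp only [mem_preimage, mem_Ioi, lt_iSup_iff, mem_iUnion, mem_inter_iff, mem_ofPred_eq,
      exists_prop]
    refine exists_congr fun y => and_congr_right fun h => ?_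
    exact ENNReal.lt_div_iff_mul_lt (Or.inl h.1.ne') (Or.inl h.2.ne_top)
  rw [this]
  refine isOpen_iUnion fun y => ((isOpen_lt ?_ ?_).inter (isOpen_lt ?_ ?_)).inter (isOpen_lt ?_ ?_)
  · exact continuous_const
  · exact continuous_const.edist continuous_id
  · exact continuous_const.edist continuous_id
  · exact continuous_const
  · exact (ENNReal.continuous_const_mul hc).comp (continuous_const.edist continuous_id)
  · exact continuous_const.edist hf.continuous

theorem laaksoPoint_ne {x y : ℝ} (hx : x ∈ Icc (0 : ℝ) 1) (hy : y ∈ Icc (0 : ℝ) 1) (hxy : x ≠ y)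
    (u v : ℕ → Bool) : laaksoPoint x u ≠ laaksoPoint y v := by
  intro h
  apply hxy
  rw [← laaksoHeight_laaksoPoint hx u, ← laaksoHeight_laaksoPoint hy v]
  exact congrArg laaksoHeight h

theorem lipschitzWith_laaksoPoint (u : ℕ → Bool) : LipschitzWith 1 fun x => laaksoPoint x u := by
  intro x y
  rw [edist_dist x y, Real.dist_eq, ENNReal.coe_one, one_mul]
  exact edist_laaksoPoint_le x y u

/-- The fibre map is 1-Lipschitz, so a difference quotient with respect to height is at most the one
with respect to d. Distinct heights in [0,1] give distinct points; hence x is interior. -/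
theorem enorm_deriv_le_pointwiseLip {f : Laakso → ℝ} {u : ℕ → Bool} {x : ℝ}
    (hx : x ∈ Ioo (0 : ℝ) 1) (hd : DifferentiableAt ℝ (fun y => f (laaksoPoint y u)) x) :
    ‖deriv (fun y => f (laaksoPoint y u)) x‖ₑ ≤ pointwiseLip f (laaksoPoint x u) := by
  have hslope := (hd.hasDerivAt.tendsto_slope).enorm
  have hmap : map (fun y => laaksoPoint y u) (𝓝[≠] x) ≤ 𝓝[≠] (laaksoPoint x u) := by
    refine tendsto_nhdsWithin_iff.2 ⟨?_, ?_⟩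
    · exact ((lipschitzWith_laaksoPoint u).continuous.tendsto x).mono_left nhdsWithin_le_nhds
    · filter_upwards [self_mem_nhdsWithin, mem_nhdsWithin_of_mem_nhds (Icc_mem_nhds hx.1 hx.2)]
        with y hy hy'
      exact laaksoPoint_ne hy' (Ioo_subset_Icc_self hx) hy u u
  rw [← hslope.limsup_eq]
  refine le_trans (limsup_le_limsup (v := fun y => edist (f (laaksoPoint y u))
      (f (laaksoPoint x u)) / edist (laaksoPoint y u) (laaksoPoint x u)) ?_)
    (limsup_le_limsup_of_le (u := fun z => edist (f z) (f (laaksoPoint x u)) /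
      edist z (laaksoPoint x u)) hmap)
  filter_upwards [self_mem_nhdsWithin] with y hy
  rw [slope_def_field, div_eq_mul_inv, enorm_mul, enorm_inv (sub_ne_zero.2 hy), ← div_eq_mul_inv,
    ← edist_eq_enorm_sub, ← edist_eq_enorm_sub]
  refine ENNReal.div_le_div_left ?_ _
  simpa using lipschitzWith_laaksoPoint u y x

/-- The pointwise Lipschitz constant is an upper gradient along segments with constant address. -/
theorem edist_le_lintegral_pointwiseLip {f : Laakso → ℝ} {L : ℝ≥0} (hf : LipschitzWith L f)
    (u : ℕ → Bool) {a b : ℝ} (ha : a ∈ Icc (0 : ℝ) 1) (hb : b ∈ Icc (0 : ℝ) 1) :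
    edist (f (laaksoPoint a u)) (f (laaksoPoint b u)) ≤
      ∫⁻ x in uIcc a b, pointwiseLip f (laaksoPoint x u) := by
  have hg : LipschitzWith (L * 1) fun y => f (laaksoPoint y u) :=
    hf.comp (lipschitzWith_laaksoPoint u)
  -- A Lipschitz function of the height is absolutely continuous, hence the integral of its
  -- derivative.
  have hint := (hg.lipschitzOnWith (s := uIcc b a)).absolutelyContinuousOnInterval.integral_deriv_eq_sub
  rw [edist_eq_enorm_sub, ← hint, intervalIntegral.intervalIntegral_eq_integral_uIoc, enorm_smul]
  have h1 : ‖(if b ≤ a then (1 : ℝ) else -1)‖ₑ = 1 := by split_ifs <;> simp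
  rw [h1, one_mul]
  refine (enorm_integral_le_lintegral_enorm _).trans ?_
  refine (lintegral_mono_ae ?_).trans (lintegral_mono_set (t := uIcc a b) ?_)
  · have hne : ∀ c : ℝ, ∀ᵐ x : ℝ, x ≠ c := fun c => by simp [ae_iff]
    rw [ae_restrict_iff' measurableSet_uIoc]
    filter_upwards [hg.ae_differentiableAt_real, hne 0, hne 1] with x hx h0 h1 hxab
    refine enorm_deriv_le_pointwiseLip ?_ hx
    have := (ordConnected_Icc.uIcc_subset hb ha) (uIoc_subset_uIcc hxab)
    exact ⟨lt_of_le_of_ne this.1 (Ne.symm h0), lt_of_le_of_ne this.2 h1⟩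
  · rw [uIcc_comm]
    exact uIoc_subset_uIcc

/-! ### Bernoulli measures on binary sequences -/

/-- The sequence that follows `u` before place `k` and `v` from place `k` on. -/
def splice (k : ℕ) (u v : ℕ → Bool) (i : ℕ) : Bool := if i < k then u i else v i

/-- The cylinder of the sequences that agree with `b` before place `n`. -/
def binaryCylinder (n : ℕ) (b : ℕ → Bool) : Set (ℕ → Bool) := {u | ∀ i < n, b i = u i}

theorem measurable_splice (k : ℕ) :
    Measurable fun z : (ℕ → Bool) × (ℕ → Bool) => splice k z.1 z.2 := by
  refine measurable_pi_lambda _ fun i => ?_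
  unfold splice
  split_ifs <;> fun_prop

theorem measurable_splice_right (k : ℕ) (b : ℕ → Bool) : Measurable (splice k b) :=
  (measurable_splice k).comp measurable_prodMk_left

theorem binaryCylinder_eq_pi (n : ℕ) (b : ℕ → Bool) :
    binaryCylinder n b = Set.pi (Finset.range n) fun i => {b i} := by
  ext u
  simp [binaryCylinder, Set.mem_pi, eq_comm]

theorem measurableSet_binaryCylinder (n : ℕ) (b : ℕ → Bool) :
    MeasurableSet (binaryCylinder n b) := by
  rw [binaryCylinder_eq_pi]
  exact MeasurableSet.pi (Finset.countable_toSet _) fun _ _ => measurableSet_singleton _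

section Bernoulli

variable (p : Measure Bool) [IsProbabilityMeasure p]

/-- The coordinates are independent, so taking the first k from one copy and the rest from an
independent copy gives the same law. This holds for every p and is what makes the chaining argument
insensitive to the weights. -/
theorem map_splice_infinitePi (k : ℕ) :
    ((Measure.infinitePi fun _ : ℕ => p).prod (Measure.infinitePi fun _ : ℕ => p)).map
      (fun z => splice k z.1 z.2) = Measure.infinitePi fun _ : ℕ => p := by
  refine Measure.eq_infinitePi _ fun s t ht => ?_
  rw [Measure.map_apply (measurable_splice k)
    (MeasurableSet.pi (Finset.countable_toSet _) fun i _ => ht i)]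
  have : (fun z : (ℕ → Bool) × (ℕ → Bool) => splice k z.1 z.2) ⁻¹' Set.pi s t =
      Set.pi (s.filter (· < k)) t ×ˢ Set.pi (s.filter (¬ · < k)) t := by
    ext z
    simp only [mem_preimage, Set.mem_pi, mem_prod, Finset.mem_coe, Finset.mem_filter, splice]
    constructor
    · refine fun h => ⟨fun i hi => ?_, fun i hi => ?_⟩
      · simpa [hi.2] using h i hi.1
      · simpa [hi.2] using h i hi.1
    · intro h i hi
      split_ifs with hk
      · exact h.1 i ⟨hi, hk⟩
      · exact h.2 i ⟨hi, hk⟩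
  rw [this, Measure.prod_prod, Measure.infinitePi_pi _ fun i _ => ht i,
    Measure.infinitePi_pi _ fun i _ => ht i, Finset.prod_filter_mul_prod_filter_not]

theorem lintegral_lintegral_splice (k : ℕ) {G : (ℕ → Bool) → ℝ≥0∞} (hG : Measurable G) :
    ∫⁻ u, ∫⁻ v, G (splice k u v) ∂(Measure.infinitePi fun _ : ℕ => p)
      ∂(Measure.infinitePi fun _ : ℕ => p) = ∫⁻ u, G u ∂(Measure.infinitePi fun _ : ℕ => p) := by
  conv_rhs => rw [← map_splice_infinitePi p k]
  rw [lintegral_map hG (measurable_splice k), lintegral_prod]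
  exact (hG.comp (measurable_splice k)).aemeasurable

/-- Conditioned on the first n digits, the tail keeps its law. -/
theorem setLIntegral_binaryCylinder (n : ℕ) (b : ℕ → Bool) {G : (ℕ → Bool) → ℝ≥0∞}
    (hG : Measurable G) :
    ∫⁻ u in binaryCylinder n b, G u ∂(Measure.infinitePi fun _ : ℕ => p) =
      (Measure.infinitePi fun _ : ℕ => p) (binaryCylinder n b) *
        ∫⁻ v, G (splice n b v) ∂(Measure.infinitePi fun _ : ℕ => p) := by
  have hC := measurableSet_binaryCylinder n b
  rw [← lintegral_indicator hC, ← lintegral_lintegral_splice p n (hG.indicator hC)]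
  have : ∀ u, ∫⁻ v, (binaryCylinder n b).indicator G (splice n u v)
      ∂(Measure.infinitePi fun _ : ℕ => p) = (binaryCylinder n b).indicator
        (fun _ => ∫⁻ v, G (splice n b v) ∂(Measure.infinitePi fun _ : ℕ => p)) u := by
    intro u
    by_cases hu : u ∈ binaryCylinder n b
    · rw [indicator_of_mem hu]
      refine lintegral_congr fun v => ?_
      have h1 : splice n u v = splice n b v := by
        ext i
        by_cases hi : i < n <;> simp [splice, hi]
        exact (hu i hi).symm
      rw [h1, indicator_of_mem]
      intro i hi
      simp [splice, hi]
    · rw [indicator_of_notMem hu]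
      refine (lintegral_congr fun v => ?_).trans lintegral_zero
      refine indicator_of_notMem (fun h => hu fun i hi => ?_) _
      simpa [splice, hi] using h i hi
  rw [lintegral_congr this, lintegral_indicator_const hC, mul_comm]

theorem infinitePi_binaryCylinder (n : ℕ) (b : ℕ → Bool) :
    (Measure.infinitePi fun _ : ℕ => p) (binaryCylinder n b) = ∏ i ∈ Finset.range n, p {b i} := by
  rw [binaryCylinder_eq_pi, Measure.infinitePi_pi _ fun i _ => measurableSet_singleton _]

theorem infinitePi_binaryCylinder_add_ge {c : ℝ≥0∞} (hc : ∀ b, c ≤ p {b}) (n m : ℕ)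
    (b : ℕ → Bool) :
    c ^ m * (Measure.infinitePi fun _ : ℕ => p) (binaryCylinder n b) ≤
      (Measure.infinitePi fun _ : ℕ => p) (binaryCylinder (n + m) b) := by
  rw [infinitePi_binaryCylinder, infinitePi_binaryCylinder, Finset.prod_range_add, mul_comm]
  gcongr
  calc c ^ m = ∏ _i ∈ Finset.range m, c := by simp
    _ ≤ _ := Finset.prod_le_prod' fun i _ => hc _

/-- At most one factor of the product changes. This compares the masses of twin cylinders. -/
theorem infinitePi_binaryCylinder_update_le {c : ℝ≥0∞} (hc : ∀ b, c ≤ p {b}) (n k : ℕ)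
    (b : ℕ → Bool) (d : Bool) :
    c * (Measure.infinitePi fun _ : ℕ => p) (binaryCylinder n (Function.update b k d)) ≤
      (Measure.infinitePi fun _ : ℕ => p) (binaryCylinder n b) := by
  rw [infinitePi_binaryCylinder, infinitePi_binaryCylinder]
  have hc1 : c ≤ 1 := (hc true).trans prob_le_one
  by_cases hk : k ∈ Finset.range n
  · rw [← Finset.mul_prod_erase _ _ hk, ← Finset.mul_prod_erase _ _ hk]
    have : ∏ i ∈ (Finset.range n).erase k, p {Function.update b k d i} =
        ∏ i ∈ (Finset.range n).erase k, p {b i} :=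
      Finset.prod_congr rfl fun i hi => by rw [Function.update_of_ne (Finset.ne_of_mem_erase hi)]
    rw [this, ← mul_assoc]
    gcongr
    exact (mul_le_of_le_one_right' prob_le_one).trans (hc _)
  · have : ∏ i ∈ Finset.range n, p {Function.update b k d i} =
        ∏ i ∈ Finset.range n, p {b i} :=
      Finset.prod_congr rfl fun i hi => by
        rw [Function.update_of_ne]
        rintro rfl
        exact hk hi
    rw [this]
    exact mul_le_of_le_one_left' hc1

end Bernoulli

theorem measurable_laaksoPoint : Measurable fun z : ℝ × (ℕ → Bool) => laaksoPoint z.1 z.2 :=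
  measurable_laaksoMk.comp ((continuous_projIcc.measurable.comp measurable_fst).prodMk
    (continuous_cantorPoint.measurable.comp measurable_snd))

theorem laaksoMeasure_eq_map (w : unitInterval) :
    laaksoMeasure w = ((volume.restrict (Icc (0 : ℝ) 1)).prod (Measure.infinitePi fun _ : ℕ =>
      ProbabilityTheory.bernoulliMeasure false true w)).map fun z => laaksoPoint z.1 z.2 := by
  have hvol : (volume : Measure unitInterval) =
      (volume.restrict (Icc (0 : ℝ) 1)).map (projIcc 0 1 zero_le_one) := by
    have h1 : volume.restrict (Icc (0 : ℝ) 1) = (volume : Measure unitInterval).map Subtype.val :=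
      (map_comap_subtype_coe measurableSet_Icc volume).symm
    rw [h1, Measure.map_map continuous_projIcc.measurable measurable_subtype_coe]
    have h2 : projIcc (0 : ℝ) 1 zero_le_one ∘ Subtype.val = id := by
      ext x
      simp
    rw [h2, Measure.map_id]
  rw [laaksoMeasure, cantorMeasure, hvol, Measure.map_prod_map _ _ continuous_projIcc.measurable
    cantorSetHomeomorphNatToBool.symm.continuous.measurable, Measure.map_map measurable_laaksoMk]
  · rfl
  · exact continuous_projIcc.measurable.prodMap
      cantorSetHomeomorphNatToBool.symm.continuous.measurable

/-! ### The Poincaré inequality on a column -/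

section Column

variable {g : ℝ → (ℕ → Bool) → ℝ} {h : ℝ → (ℕ → Bool) → ℝ≥0∞}

/-- The integral of `h` over the part of the height interval `[α, β]` within `δ` of `t`. -/
noncomputable def windowIntegral (h : ℝ → (ℕ → Bool) → ℝ≥0∞) (α β δ t : ℝ) (x : ℕ → Bool) : ℝ≥0∞ :=
  ∫⁻ τ in Icc α β, if |t - τ| ≤ δ then h τ x else 0

theorem measurable_windowIntegral (hh : Measurable (Function.uncurry h)) (α β δ : ℝ) :
    Measurable fun z : ℝ × (ℕ → Bool) => windowIntegral h α β δ z.1 z.2 := by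
  refine Measurable.lintegral_prod_right' (f := fun z : (ℝ × (ℕ → Bool)) × ℝ =>
    if |z.1.1 - z.2| ≤ δ then h z.2 z.1.2 else 0) ?_
  refine Measurable.ite (measurableSet_le (by fun_prop) measurable_const) ?_ measurable_const
  exact hh.comp (measurable_snd.prodMk (measurable_snd.comp measurable_fst))

/-- By Tonelli: each τ lies in the windows of a set of t of length at most 2δ. -/
theorem setLIntegral_windowIntegral_le (hh : Measurable (Function.uncurry h)) (α β δ : ℝ)
    (x : ℕ → Bool) :
    ∫⁻ t in Icc α β, windowIntegral h α β δ t x ≤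
      ENNReal.ofReal (2 * δ) * ∫⁻ τ in Icc α β, h τ x := by
  have hx : Measurable fun τ => h τ x := hh.comp measurable_prodMk_right
  unfold windowIntegral
  rw [lintegral_lintegral_swap]
  · rw [← lintegral_const_mul _ hx]
    refine lintegral_mono fun τ => ?_
    calc ∫⁻ t in Icc α β, (if |t - τ| ≤ δ then h τ x else 0)
        ≤ ∫⁻ t, (Icc (τ - δ) (τ + δ)).indicator (fun _ => h τ x) t := by
          refine (setLIntegral_le_lintegral _ _).trans (lintegral_mono fun t => ?_)
          split_ifs with ht
          · rw [indicator_of_mem]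
            rw [abs_le] at ht
            exact ⟨by linarith [ht.1], by linarith [ht.2]⟩
          · exact zero_le
      _ = ENNReal.ofReal (2 * δ) * h τ x := by
          rw [lintegral_indicator_const measurableSet_Icc, Real.volume_Icc, mul_comm]
          congr 2
          ring
  · refine Measurable.aemeasurable (Measurable.ite ?_ ?_ measurable_const)
    · exact measurableSet_le (by fun_prop) measurable_const
    · exact hx.comp measurable_snd

/-- Slide along x to a level of order k + 1 near t, where the fibres of x and y are glued, and slide
back along y. -/
theorem edist_le_windowIntegral_add
    (hgrad : ∀ u, ∀ a ∈ Icc (0 : ℝ) 1, ∀ b ∈ Icc (0 : ℝ) 1,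
      edist (g a u) (g b u) ≤ ∫⁻ x in uIcc a b, h x u)
    (hglue : ∀ k τ, IsWormholeLevel (k + 1) τ → ∀ u b, g τ (Function.update u k b) = g τ u)
    {α β : ℝ} (hα : 0 ≤ α) (hβ : β ≤ 1) {k : ℕ} (hk : 2 * (3⁻¹ : ℝ) ^ (k + 1) ≤ β - α) {t : ℝ}
    (ht : t ∈ Icc α β) {x y : ℕ → Bool} (hxy : ∀ i ≠ k, x i = y i) :
    edist (g t x) (g t y) ≤ windowIntegral h α β (2 * (3⁻¹ : ℝ) ^ (k + 1)) t x +
      windowIntegral h α β (2 * (3⁻¹ : ℝ) ^ (k + 1)) t y := by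
  set δ : ℝ := 2 * (3⁻¹ : ℝ) ^ (k + 1) with hδ
  have hδ0 : 0 < δ := by positivity
  -- [a, a + δ] is an interval of length δ that contains t and stays inside [α, β].
  set a := min t (β - δ) with ha
  have ha1 : a ≤ t := min_le_left _ _
  have ha2 : a ≤ β - δ := min_le_right _ _
  have ha3 : α ≤ a := le_min ht.1 (by linarith)
  have ha4 : t ≤ a + δ := by
    rcases min_choice t (β - δ) with h' | h' <;> rw [ha, h'] <;> linarith [ht.2]
  obtain ⟨l, ⟨hl1, hl2⟩, hl⟩ := exists_isWormholeLevel_mem_Icc (k := k) (x := a) (by linarith)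
    (by linarith)
  have hwin : ∀ z, edist (g t z) (g l z) ≤ windowIntegral h α β δ t z := by
    intro z
    refine (hgrad z t ⟨by linarith, by linarith [ht.2]⟩ l hl.mem_Icc).trans ?_
    have hsub : uIcc t l ⊆ Icc α β :=
      ordConnected_Icc.uIcc_subset ht ⟨by linarith, by linarith⟩
    have hsub' : uIcc t l ⊆ Icc (t - δ) (t + δ) :=
      ordConnected_Icc.uIcc_subset ⟨by linarith, by linarith⟩ ⟨by linarith, by linarith⟩
    refine le_trans (lintegral_mono_ae ?_) (lintegral_mono_set hsub)
    refine (ae_restrict_iff' measurableSet_uIcc).2 (ae_of_all _ fun τ hτ => ?_)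
    have := hsub' hτ
    rw [if_pos (abs_le.2 ⟨by linarith [this.2], by linarith [this.1]⟩)]
  have hy : y = Function.update x k (y k) := by
    ext i
    by_cases hi : i = k
    · simp [hi]
    · simp [hi, hxy i hi]
  have hgl : g l x = g l y := by
    rw [hy, hglue k l hl]
  calc edist (g t x) (g t y) ≤ edist (g t x) (g l x) + edist (g l x) (g t y) := edist_triangle _ _ _
    _ ≤ _ := by
      refine add_le_add (hwin x) ?_
      rw [hgl, edist_comm]
      exact hwin y

theorem splice_splice_self (n : ℕ) (b u v : ℕ → Bool) :
    splice n b (splice n u v) = splice n b v := by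
  ext i
  by_cases hi : i < n <;> simp [splice, hi]

theorem tendsto_splice (u v : ℕ → Bool) : Tendsto (fun k => splice k u v) atTop (𝓝 u) := by
  refine tendsto_pi_nhds.2 fun i => tendsto_const_nhds.congr' ?_
  filter_upwards [eventually_gt_atTop i] with k hk
  simp [splice, hk]

theorem continuous_splice_right (n : ℕ) (b : ℕ → Bool) : Continuous (splice n b) := by
  refine continuous_pi fun i => ?_
  unfold splice
  split_ifs <;> fun_prop

variable (p : Measure Bool) [IsProbabilityMeasure p]

local notation "ν" => Measure.infinitePi fun _ : ℕ => p

/-- The chain of addresses `splice (n + j) u v` runs from v at j = 0 to u in the limit, all prefixed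
by b; link j changes only digit n + j. Each link involves two windows, and after averaging both have
the same integral, whence the factor 2. -/
theorem lintegral_lintegral_edist_le_tsum (hh : Measurable (Function.uncurry h))
    (hgrad : ∀ u, ∀ a ∈ Icc (0 : ℝ) 1, ∀ b ∈ Icc (0 : ℝ) 1,
      edist (g a u) (g b u) ≤ ∫⁻ x in uIcc a b, h x u)
    (hglue : ∀ k τ, IsWormholeLevel (k + 1) τ → ∀ u b, g τ (Function.update u k b) = g τ u)
    (hcont : ∀ τ, Continuous (g τ))
    {α β : ℝ} (hα : 0 ≤ α) (hβ : β ≤ 1) {n : ℕ} (hn : (3⁻¹ : ℝ) ^ n ≤ β - α) {t : ℝ}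
    (ht : t ∈ Icc α β) (b : ℕ → Bool) :
    ∫⁻ u, ∫⁻ v, edist (g t (splice n b u)) (g t (splice n b v)) ∂ν ∂ν ≤
      ∑' j, 2 * ∫⁻ u, windowIntegral h α β (2 * (3⁻¹ : ℝ) ^ (n + j + 1)) t (splice n b u) ∂ν := by
  set W : ℕ → (ℕ → Bool) → ℝ≥0∞ := fun j x =>
    windowIntegral h α β (2 * (3⁻¹ : ℝ) ^ (n + j + 1)) t (splice n b x) with hW
  have hWm : ∀ j, Measurable (W j) := fun j =>
    (measurable_windowIntegral hh α β _).comp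
      (measurable_const.prodMk (measurable_splice_right n b))
  have hstep : ∀ u v, edist (g t (splice n b u)) (g t (splice n b v)) ≤
      ∑' j, (W j (splice (n + j) u v) + W j (splice (n + j + 1) u v)) := by
    intro u v
    have hlim : Tendsto (fun j => g t (splice n b (splice (n + j) u v))) atTop
        (𝓝 (g t (splice n b u))) :=
      (((hcont t).comp (continuous_splice_right n b)).tendsto u).comp
        ((tendsto_splice u v).comp (tendsto_add_atTop_nat n |>.congr fun j => by rw [add_comm]))
    have := edist_le_tsum_of_edist_le_of_tendsto₀ (f := fun j =>
      g t (splice n b (splice (n + j) u v)))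
      (fun j => W j (splice (n + j) u v) + W j (splice (n + j + 1) u v)) (fun j => ?_) hlim
    · rwa [add_zero, splice_splice_self, edist_comm] at this
    · refine edist_le_windowIntegral_add hgrad hglue hα hβ (k := n + j) ?_ ht fun i hi => ?_
      · refine le_trans ?_ hn
        have h1 : (3⁻¹ : ℝ) ^ (n + j + 1) ≤ 3⁻¹ ^ (n + 1) :=
          pow_le_pow_of_le_one (by norm_num) (by norm_num) (by omega)
        have h2 : (0 : ℝ) < 3⁻¹ ^ n := by positivity
        rw [pow_succ (3⁻¹ : ℝ) n] at h1
        linarith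
      · have h3 : i < n + j ↔ i < n + (j + 1) := by omega
        simp only [splice, h3]
  calc ∫⁻ u, ∫⁻ v, edist (g t (splice n b u)) (g t (splice n b v)) ∂ν ∂ν
      ≤ ∫⁻ u, ∫⁻ v, ∑' j, (W j (splice (n + j) u v) + W j (splice (n + j + 1) u v)) ∂ν ∂ν :=
        lintegral_mono fun u => lintegral_mono fun v => hstep u v
    _ = ∑' j, ∫⁻ u, ∫⁻ v, (W j (splice (n + j) u v) + W j (splice (n + j + 1) u v)) ∂ν ∂ν := by
        have hm : ∀ j k, Measurable fun z : (ℕ → Bool) × (ℕ → Bool) => W j (splice k z.1 z.2) :=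
          fun j k => (hWm j).comp (measurable_splice k)
        rw [← lintegral_tsum]
        · refine lintegral_congr fun u => lintegral_tsum fun j => ?_
          exact (((hm j (n + j)).add (hm j (n + j + 1))).comp measurable_prodMk_left).aemeasurable
        · exact fun j => ((hm j (n + j)).add (hm j (n + j + 1))).lintegral_prod_right'.aemeasurable
    _ = ∑' j, 2 * ∫⁻ u, W j u ∂ν := by
        refine tsum_congr fun j => ?_
        have hm : ∀ k, Measurable fun z : (ℕ → Bool) × (ℕ → Bool) => W j (splice k z.1 z.2) :=
          fun k => (hWm j).comp (measurable_splice k)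
        have h1 : ∀ u, ∫⁻ v, (W j (splice (n + j) u v) + W j (splice (n + j + 1) u v)) ∂ν =
            ∫⁻ v, W j (splice (n + j) u v) ∂ν + ∫⁻ v, W j (splice (n + j + 1) u v) ∂ν :=
          fun u => lintegral_add_left ((hm _).comp measurable_prodMk_left) _
        rw [lintegral_congr h1, lintegral_add_left (hm _).lintegral_prod_right',
          lintegral_lintegral_splice p _ (hWm j), lintegral_lintegral_splice p _ (hWm j), two_mul]

/-- On a column of rank `n` over a height interval of length at least `3⁻ⁿ`, the mean deviation
of `g` from its values at height `t₀` is controlled by the integral of the upper gradient `h`. -/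
theorem column_poincare (hh : Measurable (Function.uncurry h))
    (hgrad : ∀ u, ∀ a ∈ Icc (0 : ℝ) 1, ∀ b ∈ Icc (0 : ℝ) 1,
      edist (g a u) (g b u) ≤ ∫⁻ x in uIcc a b, h x u)
    (hglue : ∀ k τ, IsWormholeLevel (k + 1) τ → ∀ u b, g τ (Function.update u k b) = g τ u)
    (hcont : ∀ τ, Continuous (g τ))
    {α β : ℝ} (hα : 0 ≤ α) (hβ : β ≤ 1) {n : ℕ} (hn : (3⁻¹ : ℝ) ^ n ≤ β - α) {t₀ : ℝ}
    (ht₀ : t₀ ∈ Icc α β) (b : ℕ → Bool) :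
    ∫⁻ t in Icc α β, ∫⁻ u, ∫⁻ v, edist (g t (splice n b u)) (g t₀ (splice n b v)) ∂ν ∂ν ≤
      ENNReal.ofReal (4 * (3⁻¹ : ℝ) ^ n + (β - α)) *
        ∫⁻ t in Icc α β, ∫⁻ u, h t (splice n b u) ∂ν := by
  set H := ∫⁻ t in Icc α β, ∫⁻ u, h t (splice n b u) ∂ν with hH
  have hhs : Measurable fun z : ℝ × (ℕ → Bool) => h z.1 (splice n b z.2) :=
    hh.comp (measurable_fst.prodMk ((measurable_splice_right n b).comp measurable_snd))
  have hswap : ∫⁻ u, (∫⁻ t in Icc α β, h t (splice n b u)) ∂ν = H :=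
    (lintegral_lintegral_swap (f := fun t u => h t (splice n b u)) hhs.aemeasurable).symm
  have hpt : ∀ t ∈ Icc α β,
      ∫⁻ u, ∫⁻ v, edist (g t (splice n b u)) (g t₀ (splice n b v)) ∂ν ∂ν ≤
        ∑' j, 2 * ∫⁻ u, windowIntegral h α β (2 * (3⁻¹ : ℝ) ^ (n + j + 1)) t (splice n b u) ∂ν +
          H := by
    intro t ht
    -- Change the address at height t, then slide along the fibre of v to t₀.
    have h1 : ∀ u v, edist (g t (splice n b u)) (g t₀ (splice n b v)) ≤
        edist (g t (splice n b u)) (g t (splice n b v)) +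
          ∫⁻ τ in Icc α β, h τ (splice n b v) := by
      intro u v
      refine (edist_triangle _ (g t (splice n b v)) _).trans (add_le_add le_rfl ?_)
      refine (hgrad _ t ⟨hα.trans ht.1, ht.2.trans hβ⟩ t₀ ⟨hα.trans ht₀.1, ht₀.2.trans hβ⟩).trans ?_
      exact lintegral_mono_set (ordConnected_Icc.uIcc_subset ht ht₀)
    have hm : Measurable fun v => ∫⁻ τ in Icc α β, h τ (splice n b v) :=
      Measurable.lintegral_prod_right' (f := fun z : (ℕ → Bool) × ℝ => h z.2 (splice n b z.1))
        (hhs.comp measurable_swap)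
    refine (lintegral_mono fun u => (lintegral_mono fun v => h1 u v).trans_eq
      (lintegral_add_right _ hm)).trans ?_
    rw [lintegral_add_right _ measurable_const, lintegral_const, measure_univ, mul_one, hswap]
    exact add_le_add (lintegral_lintegral_edist_le_tsum p hh hgrad hglue hcont hα hβ hn ht b) le_rfl
  have hWm : ∀ j, Measurable fun z : ℝ × (ℕ → Bool) =>
      windowIntegral h α β (2 * (3⁻¹ : ℝ) ^ (n + j + 1)) z.1 (splice n b z.2) := fun j =>
    (measurable_windowIntegral hh α β _).comp
      (measurable_fst.prodMk ((measurable_splice_right n b).comp measurable_snd))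
  have hWint : ∀ j, ∫⁻ t in Icc α β, ∫⁻ u,
      windowIntegral h α β (2 * (3⁻¹ : ℝ) ^ (n + j + 1)) t (splice n b u) ∂ν ≤
        ENNReal.ofReal (2 * (2 * (3⁻¹ : ℝ) ^ (n + j + 1))) * H := by
    intro j
    rw [lintegral_lintegral_swap (hWm j).aemeasurable, ← hswap, ← lintegral_const_mul']
    · exact lintegral_mono fun u => setLIntegral_windowIntegral_le hh α β _ _
    · exact ENNReal.ofReal_ne_top
  -- Two windows, each of half-width 2·3^-(n+j+1): the sum is 8·3^-(n+1)·(3/2).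
  have hgeom : ∑' j : ℕ, 2 * ENNReal.ofReal (2 * (2 * (3⁻¹ : ℝ) ^ (n + j + 1))) =
      ENNReal.ofReal (4 * (3⁻¹ : ℝ) ^ n) := by
    have hs : HasSum (fun j : ℕ => 8 * (3⁻¹ : ℝ) ^ (n + j + 1)) (4 * (3⁻¹ : ℝ) ^ n) := by
      have h1 := (hasSum_geometric_of_lt_one (r := (3⁻¹ : ℝ)) (by norm_num) (by norm_num)).mul_left
        (8 * (3⁻¹ : ℝ) ^ (n + 1))
      have e1 : (fun j : ℕ => 8 * (3⁻¹ : ℝ) ^ (n + j + 1)) =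
          fun j => 8 * (3⁻¹ : ℝ) ^ (n + 1) * 3⁻¹ ^ j := by
        ext j
        ring
      have e2 : 4 * (3⁻¹ : ℝ) ^ n = 8 * (3⁻¹ : ℝ) ^ (n + 1) * (1 - 3⁻¹)⁻¹ := by
        rw [pow_succ, show (1 - (3 : ℝ)⁻¹)⁻¹ = 3 / 2 by norm_num]
        ring
      rw [e1, e2]
      exact h1
    rw [← hs.tsum_eq, ENNReal.ofReal_tsum_of_nonneg (fun j => by positivity) hs.summable]
    refine tsum_congr fun j => ?_
    rw [show (2 : ℝ≥0∞) = ENNReal.ofReal 2 by simp, ← ENNReal.ofReal_mul (by norm_num)]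
    congr 1
    ring
  calc ∫⁻ t in Icc α β, ∫⁻ u, ∫⁻ v, edist (g t (splice n b u)) (g t₀ (splice n b v)) ∂ν ∂ν
      ≤ ∫⁻ t in Icc α β, (∑' j, 2 * ∫⁻ u,
          windowIntegral h α β (2 * (3⁻¹ : ℝ) ^ (n + j + 1)) t (splice n b u) ∂ν + H) :=
        setLIntegral_mono' measurableSet_Icc hpt
    _ = (∑' j, 2 * ∫⁻ t in Icc α β, ∫⁻ u,
          windowIntegral h α β (2 * (3⁻¹ : ℝ) ^ (n + j + 1)) t (splice n b u) ∂ν) +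
            ENNReal.ofReal (β - α) * H := by
        rw [lintegral_add_right _ measurable_const, lintegral_const, Measure.restrict_apply_univ,
          Real.volume_Icc, mul_comm H, lintegral_tsum]
        · congr 1
          exact tsum_congr fun j => lintegral_const_mul _ (hWm j).lintegral_prod_right'
        · exact fun j => ((hWm j).lintegral_prod_right'.const_mul _).aemeasurable
    _ ≤ (∑' j : ℕ, 2 * ENNReal.ofReal (2 * (2 * (3⁻¹ : ℝ) ^ (n + j + 1))) * H) +
          ENNReal.ofReal (β - α) * H := by
        refine add_le_add (ENNReal.tsum_le_tsum fun j => ?_) le_rfl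
        rw [mul_assoc]
        gcongr
        exact hWint j
    _ = ENNReal.ofReal (4 * (3⁻¹ : ℝ) ^ n + (β - α)) * H := by
        rw [ENNReal.tsum_mul_right, hgeom, ← add_mul, ENNReal.ofReal_add (by positivity)]
        linarith [ht₀.1, ht₀.2]

end Column

/-! ### Balls in Laakso space -/

/-- The finest triadic scale still at least 2r, or scale 1 for large r; it is comparable to r unless
r is large. -/
theorem exists_scale {r : ℝ} (hr : 0 < r) :
    ∃ n : ℕ, (n = 0 ∨ 2 * r ≤ (3⁻¹ : ℝ) ^ n) ∧ (3⁻¹ : ℝ) ^ n < 6 * r := by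
  rcases lt_or_ge 1 (2 * r) with h | h
  · exact ⟨0, Or.inl rfl, by rw [pow_zero]; linarith⟩
  · obtain ⟨n, hn1, hn2⟩ := exists_nat_pow_near_of_lt_one (y := (3⁻¹ : ℝ)) (x := 2 * r)
      (by linarith) h (by norm_num) (by norm_num)
    refine ⟨n, Or.inr hn2, ?_⟩
    rw [pow_succ] at hn1
    linarith

section Balls

variable (p : Measure Bool) [IsProbabilityMeasure p]

local notation "ν" => Measure.infinitePi fun _ : ℕ => p

/-- The image on Laakso space of the product of Lebesgue measure and a Bernoulli measure. -/
noncomputable def laaksoProductMeasure : Measure Laakso :=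
  ((volume.restrict (Icc (0 : ℝ) 1)).prod ν).map fun z => laaksoPoint z.1 z.2

instance : IsFiniteMeasure (laaksoProductMeasure p) := by
  unfold laaksoProductMeasure
  infer_instance

theorem laaksoProductMeasure_apply {s : Set Laakso} (hs : MeasurableSet s) :
    laaksoProductMeasure p s = ((volume : Measure ℝ).prod ν)
      ((fun z => laaksoPoint z.1 z.2) ⁻¹' s ∩ Icc (0 : ℝ) 1 ×ˢ univ) := by
  rw [laaksoProductMeasure, Measure.map_apply measurable_laaksoPoint hs,
    ← Measure.restrict_univ (μ := ν), Measure.prod_restrict, Measure.restrict_univ,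
    Measure.restrict_apply (measurable_laaksoPoint hs)]

theorem setLIntegral_laaksoProductMeasure {s : Set Laakso} (hs : MeasurableSet s)
    {G : Laakso → ℝ≥0∞} (hG : Measurable G) :
    ∫⁻ x in s, G x ∂(laaksoProductMeasure p) =
      ∫⁻ z in (fun z => laaksoPoint z.1 z.2) ⁻¹' s ∩ Icc (0 : ℝ) 1 ×ˢ univ,
        G (laaksoPoint z.1 z.2) ∂((volume : Measure ℝ).prod ν) := by
  rw [laaksoProductMeasure, setLIntegral_map hs hG measurable_laaksoPoint,
    ← Measure.restrict_univ (μ := ν), Measure.prod_restrict, Measure.restrict_univ,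
    Measure.restrict_restrict (measurable_laaksoPoint hs)]

theorem edist_laaksoPoint_lt_of_agree {t t' a b r : ℝ} (ht : t ∈ Icc (0 : ℝ) 1) {N : ℕ}
    {u u' : ℕ → Bool} (hu : ∀ i < N, u i = u' i) (ha : 2 * (3⁻¹ : ℝ) ^ N ≤ a) (hb : |t - t'| ≤ b)
    (hab : a + b < r) :
    edist (laaksoPoint t u) (laaksoPoint t' u') < ENNReal.ofReal r := by
  have h0 : (0 : ℝ) < 3⁻¹ ^ N := by positivity
  have h1 := abs_nonneg (t - t')
  calc edist (laaksoPoint t u) (laaksoPoint t' u')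
      ≤ edist (laaksoPoint t u) (laaksoPoint t u') +
          edist (laaksoPoint t u') (laaksoPoint t' u') := edist_triangle _ _ _
    _ ≤ ENNReal.ofReal a + ENNReal.ofReal b :=
        add_le_add ((edist_laaksoPoint_le_of_agree ht hu).trans (ENNReal.ofReal_le_ofReal ha))
          ((edist_laaksoPoint_le _ _ _).trans (ENNReal.ofReal_le_ofReal hb))
    _ < ENNReal.ofReal r := by
        rw [← ENNReal.ofReal_add (by linarith) (by linarith)]
        exact (ENNReal.ofReal_lt_ofReal_iff (by linarith)).2 hab

/-- The ball contains a product: half the radius is spent on height, on whichever side of t has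
room, and half on the digits from place N on. -/
theorem laaksoProductMeasure_eball_ge {t r : ℝ} (ht : t ∈ Icc (0 : ℝ) 1) (hr : 0 < r) {N : ℕ}
    (hN : 2 * (3⁻¹ : ℝ) ^ N < r / 2) (u : ℕ → Bool) :
    ENNReal.ofReal (min (r / 2) (1 / 2)) * ν (binaryCylinder N u) ≤
      laaksoProductMeasure p (Metric.eball (laaksoPoint t u) (ENNReal.ofReal r)) := by
  set c := min (r / 2) (1 / 2) with hc
  have hc1 : c ≤ r / 2 := min_le_left _ _
  have hc2 : c ≤ 1 / 2 := min_le_right _ _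
  obtain ⟨a, ha⟩ : ∃ a, Icc a (a + c) ⊆ Icc (t - r / 2) (t + r / 2) ∩ Icc 0 1 := by
    rcases le_total t (1 / 2) with h | h
    · exact ⟨t, fun y hy => ⟨⟨by linarith [hy.1], by linarith [hy.2]⟩,
        ⟨by linarith [hy.1, ht.1], by linarith [hy.2]⟩⟩⟩
    · exact ⟨t - c, fun y hy => ⟨⟨by linarith [hy.1], by linarith [hy.2]⟩,
        ⟨by linarith [hy.1], by linarith [hy.2, ht.2]⟩⟩⟩
  rw [laaksoProductMeasure_apply p Metric.isOpen_eball.measurableSet]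
  calc ENNReal.ofReal c * ν (binaryCylinder N u)
      = ((volume : Measure ℝ).prod ν) (Icc a (a + c) ×ˢ binaryCylinder N u) := by
        rw [Measure.prod_prod, Real.volume_Icc, add_sub_cancel_left]
    _ ≤ _ := by
        refine measure_mono fun z hz => ⟨?_, (ha hz.1).2, trivial⟩
        have h1 := (ha hz.1).1
        rw [mem_preimage, Metric.mem_eball, edist_comm]
        exact edist_laaksoPoint_lt_of_agree ht hz.2 le_rfl (b := r / 2)
          (abs_le.2 ⟨by linarith [h1.2], by linarith [h1.1]⟩) (by linarith)

/-- The ball lies over two twin cylinders, and the twin has at most c⁻¹ times the mass. -/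
theorem laaksoProductMeasure_eball_le {c : ℝ≥0∞} (hc0 : c ≠ 0) (hc : ∀ b, c ≤ p {b}) {t r : ℝ}
    (ht : t ∈ Icc (0 : ℝ) 1) (hr : 0 < r) {n : ℕ} (hn : n = 0 ∨ 2 * r ≤ (3⁻¹ : ℝ) ^ n)
    (u : ℕ → Bool) :
    laaksoProductMeasure p (Metric.eball (laaksoPoint t u) (ENNReal.ofReal r)) ≤
      ENNReal.ofReal (min (2 * r) 1) * ((1 + c⁻¹) * ν (binaryCylinder n u)) := by
  obtain ⟨l, -, -, k, d, -, hball⟩ := exists_twin_of_ball ht hr hn u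
  have hctop : c ≠ ⊤ := ((hc true).trans_lt (measure_lt_top _ _)).ne
  rw [laaksoProductMeasure_apply p Metric.isOpen_eball.measurableSet]
  calc _ ≤ ((volume : Measure ℝ).prod ν) ((Icc (t - r) (t + r) ∩ Icc 0 1) ×ˢ
          (binaryCylinder n u ∪ binaryCylinder n (Function.update u k d))) := by
        refine measure_mono fun z hz => ?_
        have h1 := hz.1
        rw [mem_preimage, Metric.mem_eball, edist_comm] at h1
        have h2 := abs_lt.1 (of_edist_laaksoPoint_lt ht hz.2.1 h1).1
        exact ⟨⟨⟨by linarith [h2.2], by linarith [h2.1]⟩, hz.2.1⟩, hball _ hz.2.1 _ h1⟩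
    _ ≤ ENNReal.ofReal (min (2 * r) 1) * (ν (binaryCylinder n u) +
          ν (binaryCylinder n (Function.update u k d))) := by
        rw [Measure.prod_prod]
        refine mul_le_mul' ?_ (measure_union_le _ _)
        rw [ENNReal.ofReal_min]
        refine le_min ?_ ?_
        · refine (measure_mono inter_subset_left).trans_eq ?_
          rw [Real.volume_Icc]
          congr 1
          ring
        · refine (measure_mono inter_subset_right).trans_eq ?_
          rw [Real.volume_Icc, sub_zero]
    _ ≤ _ := by
        gcongr
        rw [add_mul, one_mul]
        gcongr
        have := infinitePi_binaryCylinder_update_le p hc n k u d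
        rw [← ENNReal.div_eq_inv_mul, ENNReal.le_div_iff_mul_le (Or.inl hc0) (Or.inl hctop)]
        rwa [mul_comm]

/-- The doubling property, in the form used for the Poincaré inequality. -/
theorem exists_laaksoProductMeasure_eball_le {c : ℝ≥0∞} (hc0 : c ≠ 0) (hc : ∀ b, c ≤ p {b}) :
    ∃ D : ℝ≥0, ∀ (x : Laakso) (r : ℝ), 0 < r →
      laaksoProductMeasure p (Metric.eball x (ENNReal.ofReal (27 * r))) ≤
        D * laaksoProductMeasure p (Metric.eball x (ENNReal.ofReal r)) := by
  have hctop : c ≠ ⊤ := ((hc true).trans_lt (measure_lt_top _ _)).ne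
  have hc6 : c ^ 6 ≠ 0 := pow_ne_zero _ hc0
  have hc6' : c ^ 6 ≠ ⊤ := ENNReal.pow_ne_top hctop
  set D : ℝ≥0∞ := ENNReal.ofReal 108 * ((1 + c⁻¹) * (c ^ 6)⁻¹) with hD
  have hDtop : D ≠ ⊤ := by
    have h1 : c⁻¹ ≠ ⊤ := ENNReal.inv_ne_top.2 hc0
    have h2 : (c ^ 6)⁻¹ ≠ ⊤ := ENNReal.inv_ne_top.2 hc6
    finiteness
  refine ⟨D.toNNReal, fun x r hr => ?_⟩
  rw [ENNReal.coe_toNNReal hDtop]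
  obtain ⟨t, ht, u, rfl⟩ := exists_laaksoPoint_eq x
  obtain ⟨n, hn, hn'⟩ := exists_scale hr
  -- Enlarging the radius by 27 = 3^3 lowers the rank by 3; truncated subtraction lands in the
  -- exceptional case of rank 0.
  have hm : n - 3 = 0 ∨ 2 * (27 * r) ≤ (3⁻¹ : ℝ) ^ (n - 3) := by
    rcases Nat.lt_or_ge 3 n with h | h
    · right
      obtain ⟨j, rfl⟩ := Nat.exists_eq_add_of_lt h
      have := hn.resolve_left (by omega)
      rw [show 3 + j + 1 = (3 + j + 1 - 3) + 3 by omega, pow_add] at this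
      norm_num at this ⊢
      linarith
    · left
      omega
  -- The rank is at least n + 3, so the left side is at most 2·3^-n / 27 < 12r / 27.
  have hN : 2 * (3⁻¹ : ℝ) ^ (n - 3 + 6) < r / 2 := by
    have h1 : (3⁻¹ : ℝ) ^ (n - 3 + 6) ≤ 3⁻¹ ^ (n + 3) :=
      pow_le_pow_of_le_one (by norm_num) (by norm_num) (by omega)
    rw [pow_add (3⁻¹ : ℝ) n 3] at h1
    norm_num at h1 hn' ⊢
    linarith
  have hcyl := infinitePi_binaryCylinder_add_ge p hc (n - 3) 6 u
  calc laaksoProductMeasure p (Metric.eball (laaksoPoint t u) (ENNReal.ofReal (27 * r)))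
      ≤ ENNReal.ofReal (min (2 * (27 * r)) 1) * ((1 + c⁻¹) * ν (binaryCylinder (n - 3) u)) :=
        laaksoProductMeasure_eball_le p hc0 hc ht (by linarith) hm u
    _ ≤ (ENNReal.ofReal 108 * ENNReal.ofReal (min (r / 2) (1 / 2))) * ((1 + c⁻¹) *
          ((c ^ 6)⁻¹ * ν (binaryCylinder (n - 3 + 6) u))) := by
        gcongr
        · rw [← ENNReal.ofReal_mul (by norm_num)]
          refine ENNReal.ofReal_le_ofReal ?_
          rcases min_choice (r / 2) (1 / 2) with h | h <;> rw [h]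
          · exact (min_le_left _ _).trans (by linarith)
          · exact (min_le_right _ _).trans (by norm_num)
        · rw [← ENNReal.div_eq_inv_mul, ENNReal.le_div_iff_mul_le (Or.inl hc6) (Or.inl hc6')]
          rwa [mul_comm]
    _ = D * (ENNReal.ofReal (min (r / 2) (1 / 2)) * ν (binaryCylinder (n - 3 + 6) u)) := by
        rw [hD]
        ring
    _ ≤ D * laaksoProductMeasure p (Metric.eball (laaksoPoint t u) (ENNReal.ofReal r)) := by
        gcongr
        exact laaksoProductMeasure_eball_ge p ht hr hN u

end Balls

/-! ### The Poincaré inequality -/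

/-- The mean differs from c by at most the mean deviation from c, so any convenient constant can
replace the mean at the cost of a factor 2. -/
theorem lintegral_enorm_sub_average_le {X : Type*} [MeasurableSpace X] (μ : Measure X)
    [IsFiniteMeasure μ] {f : X → ℝ} (hf : Measurable f) (c : ℝ) :
    ∫⁻ y, ‖f y - ⨍ z, f z ∂μ‖ₑ ∂μ ≤ 2 * ∫⁻ y, ‖f y - c‖ₑ ∂μ := by
  rcases eq_or_ne μ 0 with rfl | hμ
  · simp
  have hμ' : μ univ ≠ 0 := by simpa using hμ
  rcases eq_or_ne (∫⁻ y, ‖f y - c‖ₑ ∂μ) ⊤ with h | h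
  · rw [h, ENNReal.mul_top two_ne_zero]
    exact le_top
  have hint : Integrable (fun y => f y - c) μ :=
    ⟨(hf.sub_const c).aestronglyMeasurable, lt_top_iff_ne_top.2 h⟩
  have hf' : Integrable f μ := by
    refine (hint.add (integrable_const c)).congr (ae_of_all _ fun y => ?_)
    simp
  have havg : c - ⨍ z, f z ∂μ = -⨍ z, (f z - c) ∂μ := by
    have : NeZero μ := ⟨hμ⟩
    rw [average_eq, average_eq, integral_sub hf' (integrable_const c), integral_const, smul_sub,
      smul_eq_mul, smul_eq_mul, smul_eq_mul, inv_mul_cancel_left₀ measureReal_univ_ne_zero]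
    ring
  have hc : ‖c - ⨍ z, f z ∂μ‖ₑ ≤ (μ univ)⁻¹ * ∫⁻ y, ‖f y - c‖ₑ ∂μ := by
    rw [havg, enorm_neg, average]
    refine (enorm_integral_le_lintegral_enorm _).trans_eq ?_
    rw [lintegral_smul_measure, smul_eq_mul]
  calc ∫⁻ y, ‖f y - ⨍ z, f z ∂μ‖ₑ ∂μ
      ≤ ∫⁻ y, (‖f y - c‖ₑ + (μ univ)⁻¹ * ∫⁻ y, ‖f y - c‖ₑ ∂μ) ∂μ := by
        refine lintegral_mono fun y => ?_
        refine le_trans ?_ (add_le_add le_rfl hc)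
        rw [← sub_add_sub_cancel (f y) c]
        exact enorm_add_le _ _
    _ = 2 * ∫⁻ y, ‖f y - c‖ₑ ∂μ := by
        rw [lintegral_add_right _ measurable_const, lintegral_const, mul_right_comm,
          ENNReal.inv_mul_cancel hμ' (measure_ne_top _ _), one_mul, two_mul]

section Poincare

variable (p : Measure Bool) [IsProbabilityMeasure p]

local notation "ν" => Measure.infinitePi fun _ : ℕ => p

/-- The deviation of a Lipschitz function from a mean value at height `l`, over a product of a
height interval and a cylinder. -/
theorem setLIntegral_enorm_sub_integral_le {f : Laakso → ℝ} {L : ℝ≥0} (hf : LipschitzWith L f)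
    {α β : ℝ} (hα : 0 ≤ α) (hβ : β ≤ 1) {n : ℕ} (hn : (3⁻¹ : ℝ) ^ n ≤ β - α) {l : ℝ}
    (hl : l ∈ Icc α β) (b : ℕ → Bool) :
    ∫⁻ z in Icc α β ×ˢ binaryCylinder n b,
        ‖f (laaksoPoint z.1 z.2) - ∫ v, f (laaksoPoint l (splice n b v)) ∂ν‖ₑ
          ∂((volume : Measure ℝ).prod ν) ≤
      ENNReal.ofReal (4 * (3⁻¹ : ℝ) ^ n + (β - α)) *
        ∫⁻ z in Icc α β ×ˢ binaryCylinder n b, pointwiseLip f (laaksoPoint z.1 z.2)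
          ∂((volume : Measure ℝ).prod ν) := by
  set c := ∫ v, f (laaksoPoint l (splice n b v)) ∂ν with hc
  have hfm : Measurable f := hf.continuous.measurable
  have hfc : ∀ τ, Continuous fun u => f (laaksoPoint τ u) := fun τ =>
    hf.continuous.comp (continuous_laaksoPoint.comp (continuous_const.prodMk continuous_id))
  have hLip := measurable_pointwiseLip hf
  have hprod : ∀ G : ℝ → (ℕ → Bool) → ℝ≥0∞, Measurable (Function.uncurry G) →
      ∫⁻ z in Icc α β ×ˢ binaryCylinder n b, G z.1 z.2 ∂((volume : Measure ℝ).prod ν) =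
        ν (binaryCylinder n b) * ∫⁻ t in Icc α β, ∫⁻ u, G t (splice n b u) ∂ν := by
    intro G hG
    rw [← Measure.prod_restrict, lintegral_prod (fun z => G z.1 z.2) hG.aemeasurable, ← lintegral_const_mul']
    · exact lintegral_congr fun t =>
        setLIntegral_binaryCylinder p n b (hG.comp measurable_prodMk_left)
    · exact measure_ne_top _ _
  rw [hprod (fun t u => ‖f (laaksoPoint t u) - c‖ₑ)
      ((hfm.comp measurable_laaksoPoint).sub_const c).enorm,
    hprod (fun t u => pointwiseLip f (laaksoPoint t u)) (hLip.comp measurable_laaksoPoint),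
    mul_left_comm]
  refine mul_le_mul' le_rfl ?_
  refine le_trans ?_ (column_poincare p (g := fun t u => f (laaksoPoint t u))
    (h := fun t u => pointwiseLip f (laaksoPoint t u)) (hLip.comp measurable_laaksoPoint)
    (fun u a ha a' ha' => edist_le_lintegral_pointwiseLip hf u ha ha')
    (fun k τ hτ u d => congrArg f (laaksoPoint_update hτ u d)) hfc hα hβ hn hl b)
  refine lintegral_mono fun t => lintegral_mono fun u => ?_
  have hint : Integrable (fun v => f (laaksoPoint l (splice n b v))) ν :=
    ((hfc l).comp (continuous_splice_right n b)).integrable_of_hasCompactSupport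
      (HasCompactSupport.of_compactSpace _)
  -- Writing the deviation from a mean as a mean of differences brings it into the form of
  -- `column_poincare`.
  have heq : f (laaksoPoint t (splice n b u)) - c =
      ∫ v, (f (laaksoPoint t (splice n b u)) - f (laaksoPoint l (splice n b v))) ∂ν := by
    rw [integral_sub (integrable_const _) hint, integral_const, probReal_univ, one_smul]
  rw [heq]
  refine (enorm_integral_le_lintegral_enorm _).trans_eq (lintegral_congr fun v => ?_)
  rw [edist_eq_enorm_sub]

/-- The ball is covered by two columns glued at height l, so the means of f at that height over both
cylinders are the same number c. Each column costs at most 6·3^-n < 36r, and both lie in the larger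
ball. -/
theorem exists_setLIntegral_enorm_sub_le {f : Laakso → ℝ} {L : ℝ≥0} (hf : LipschitzWith L f)
    (x : Laakso) {r : ℝ} (hr : 0 < r) :
    ∃ c : ℝ, ∫⁻ y in Metric.eball x (ENNReal.ofReal r), ‖f y - c‖ₑ ∂(laaksoProductMeasure p) ≤
      ENNReal.ofReal (72 * r) *
        ∫⁻ y in Metric.eball x (ENNReal.ofReal (27 * r)), pointwiseLip f y
          ∂(laaksoProductMeasure p) := by
  obtain ⟨t, ht, u, rfl⟩ := exists_laaksoPoint_eq x
  obtain ⟨n, hn, hn'⟩ := exists_scale hr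
  obtain ⟨l, hl, htl, k, d, hk, hball⟩ := exists_twin_of_ball ht hr hn u
  set u' := Function.update u k d with hu'
  have hq : (0 : ℝ) < 3⁻¹ ^ n := by positivity
  have hq1 : (3⁻¹ : ℝ) ^ n ≤ 1 := pow_le_one₀ (by norm_num) (by norm_num)
  -- Heights within 3^-n of t, clipped to [0,1]; clipping leaves length at least 3^-n.
  set α := max 0 (t - 3⁻¹ ^ n) with hα
  set β := min 1 (t + 3⁻¹ ^ n) with hβ
  have hα0 : 0 ≤ α := le_max_left _ _
  have hβ1 : β ≤ 1 := min_le_left _ _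
  have hαt : t - 3⁻¹ ^ n ≤ α := le_max_right _ _
  have hβt : β ≤ t + 3⁻¹ ^ n := min_le_right _ _
  have hlen : (3⁻¹ : ℝ) ^ n ≤ β - α := by
    rcases max_choice 0 (t - (3⁻¹ : ℝ) ^ n) with h1 | h1 <;>
      rcases min_choice 1 (t + (3⁻¹ : ℝ) ^ n) with h2 | h2 <;>
        rw [hα, hβ, h1, h2] <;> linarith [ht.1, ht.2]
  have hnear : ∀ y ∈ Icc (0 : ℝ) 1, |t - y| < r → y ∈ Icc α β := by
    intro y hy hty
    have h1 : |t - y| ≤ 3⁻¹ ^ n := by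
      rcases hn with rfl | hn
      · rw [pow_zero, abs_le]
        constructor <;> linarith [ht.1, ht.2, hy.1, hy.2]
      · linarith
    rw [abs_le] at h1
    exact ⟨max_le hy.1 (by linarith [h1.2]), le_min hy.2 (by linarith [h1.1])⟩
  have htwin : ∀ v, laaksoPoint l (splice n u v) = laaksoPoint l (splice n u' v) := by
    intro v
    by_cases hkn : k < n
    · have : splice n u' v = Function.update (splice n u v) k d := by
        ext i
        by_cases hi : i = k
        · subst hi
          simp [splice, hkn, hu']
        · simp [splice, hi, hu']
      rw [this, laaksoPoint_update (hk hkn)]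
    -- For k ≥ n the update does not touch the first n digits, so the two columns coincide.
    · have : splice n u' v = splice n u v := by
        ext i
        by_cases hi : i < n
        · have : i ≠ k := by omega
          simp [splice, hi, hu', this]
        · simp [splice, hi]
      rw [this]
  have hlJ := hnear l hl htl
  set c := ∫ v, f (laaksoPoint l (splice n u v)) ∂ν with hc
  have hc' : c = ∫ v, f (laaksoPoint l (splice n u' v)) ∂ν := by
    simp only [hc, htwin]
  set B := (fun z : ℝ × (ℕ → Bool) => laaksoPoint z.1 z.2) ⁻¹'
    Metric.eball (laaksoPoint t u) (ENNReal.ofReal (27 * r)) ∩ Icc (0 : ℝ) 1 ×ˢ univ with hB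
  have hJ : ∀ y ∈ Icc α β, y ∈ Icc (0 : ℝ) 1 := fun y hy => ⟨hα0.trans hy.1, hy.2.trans hβ1⟩
  have hsub : ∀ b, (∀ v, laaksoPoint l (splice n u v) = laaksoPoint l (splice n b v)) →
      Icc α β ×ˢ binaryCylinder n b ⊆ B := by
    intro b hb z hz
    refine ⟨?_, hJ _ hz.1, trivial⟩
    rw [mem_preimage, Metric.mem_eball, edist_comm]
    have h1 : splice n b z.2 = z.2 := by
      ext i
      by_cases hi : i < n
      · simpa [splice, hi] using hz.2 i hi
      · simp [splice, hi]
    have h2 : |l - z.1| ≤ 2 * 3⁻¹ ^ n :=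
      abs_le.2 ⟨by linarith [hlJ.1, hz.1.2], by linarith [hlJ.2, hz.1.1]⟩
    -- Go to height l with the tail of z (less than 2·3^-n + r up to slack, below 14r), cross to the
    -- column of b, then slide to height z.1 (at most 2·3^-n < 12r).
    calc edist (laaksoPoint t u) (laaksoPoint z.1 z.2)
        ≤ edist (laaksoPoint t u) (laaksoPoint l (splice n u z.2)) +
            edist (laaksoPoint l z.2) (laaksoPoint z.1 z.2) := by
          refine (edist_triangle _ (laaksoPoint l (splice n u z.2)) _).trans_eq ?_
          rw [hb, h1]
      _ ≤ ENNReal.ofReal (14 * r) + ENNReal.ofReal (12 * r) := by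
          refine add_le_add (le_of_lt ?_) ((edist_laaksoPoint_le _ _ _).trans
            (ENNReal.ofReal_le_ofReal (by linarith)))
          exact edist_laaksoPoint_lt_of_agree ht (N := n) (fun i hi => by simp [splice, hi])
            le_rfl htl.le (by linarith)
      _ < ENNReal.ofReal (27 * r) := by
          rw [← ENNReal.ofReal_add (by linarith) (by linarith)]
          exact (ENNReal.ofReal_lt_ofReal_iff (by linarith)).2 (by linarith)
  have hcol : ∀ b, (∀ v, laaksoPoint l (splice n u v) = laaksoPoint l (splice n b v)) →
      c = ∫ v, f (laaksoPoint l (splice n b v)) ∂ν →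
      ∫⁻ z in Icc α β ×ˢ binaryCylinder n b, ‖f (laaksoPoint z.1 z.2) - c‖ₑ
        ∂((volume : Measure ℝ).prod ν) ≤ ENNReal.ofReal (36 * r) *
          ∫⁻ z in B, pointwiseLip f (laaksoPoint z.1 z.2) ∂((volume : Measure ℝ).prod ν) := by
    intro b hb hcb
    rw [hcb]
    refine (setLIntegral_enorm_sub_integral_le p hf hα0 hβ1 hlen hlJ b).trans ?_
    gcongr
    · linarith
    · exact hsub b hb
  refine ⟨c, ?_⟩
  have hfm : Measurable f := hf.continuous.measurable
  rw [setLIntegral_laaksoProductMeasure p Metric.isOpen_eball.measurableSet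
      (hfm.sub_const c).enorm,
    setLIntegral_laaksoProductMeasure p Metric.isOpen_eball.measurableSet
      (measurable_pointwiseLip hf)]
  calc _ ≤ ∫⁻ z in Icc α β ×ˢ binaryCylinder n u ∪ Icc α β ×ˢ binaryCylinder n u',
          ‖f (laaksoPoint z.1 z.2) - c‖ₑ ∂((volume : Measure ℝ).prod ν) := by
        refine lintegral_mono_set fun z hz => ?_
        have h1 := hz.1
        rw [mem_preimage, Metric.mem_eball, edist_comm] at h1
        have h2 := hnear _ hz.2.1 (of_edist_laaksoPoint_lt ht hz.2.1 h1).1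
        exact (hball _ hz.2.1 _ h1).imp (fun h => ⟨h2, h⟩) fun h => ⟨h2, h⟩
    _ ≤ _ := lintegral_union_le _ _ _
    _ ≤ _ := add_le_add (hcol u (fun _ => rfl) hc) (hcol u' htwin hc')
    _ = _ := by
        rw [← add_mul, ← ENNReal.ofReal_add (by linarith) (by linarith)]
        congr 2
        ring

theorem supportsPoincareOneOne_laaksoProductMeasure {c : ℝ≥0∞} (hc0 : c ≠ 0)
    (hc : ∀ b, c ≤ p {b}) : SupportsPoincareOneOne Laakso (laaksoProductMeasure p) := by
  obtain ⟨D, hD⟩ := exists_laaksoProductMeasure_eball_le p hc0 hc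
  -- 144 = 2·72: replacing the mean by a constant, then the local estimate. D is the doubling
  -- constant, and adding 1 makes positivity automatic.
  refine ⟨144 * D + 1, 27, by positivity, by norm_num, ?_⟩
  rintro f ⟨L, hf⟩ x r hr
  set μ := laaksoProductMeasure p with hμ
  set B := Metric.eball x (r : ℝ≥0∞) with hB
  set B' := Metric.eball x ((27 * r : ℝ≥0) : ℝ≥0∞) with hB'
  set H := ∫⁻ y in B', pointwiseLip f y ∂μ with hH
  have hr1 : (r : ℝ≥0∞) = ENNReal.ofReal r := by simp
  have hr2 : ((27 * r : ℝ≥0) : ℝ≥0∞) = ENNReal.ofReal (27 * r) := by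
    rw [← ENNReal.ofReal_coe_nnreal]
    simp
  have hDB : μ B' ≤ D * μ B := by
    rw [hB, hB', hr1, hr2]
    exact hD x r (by exact_mod_cast hr)
  obtain ⟨a, ha⟩ := exists_setLIntegral_enorm_sub_le p hf x (r := r) (by exact_mod_cast hr)
  rw [← hr1, ← hr2, ← hB, ← hB', ← hμ, ← hH] at ha
  have hdev := (lintegral_enorm_sub_average_le (μ.restrict B) hf.continuous.measurable a).trans
    (mul_le_mul' le_rfl ha)
  rw [setLAverage_eq, setLAverage_eq, ← hH]
  rcases eq_or_ne (μ B) 0 with h0 | h0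
  · rw [Measure.restrict_eq_zero.2 h0]
    simp
  refine ENNReal.div_le_of_le_mul (hdev.trans ?_)
  have h72 : ENNReal.ofReal (72 * r) = 72 * r := by
    rw [ENNReal.ofReal_mul (by norm_num), ← hr1]
    simp
  have hB'0 : μ B' ≠ 0 := by
    refine (lt_of_lt_of_le (pos_iff_ne_zero.2 h0) (measure_mono ?_)).ne'
    refine Metric.eball_subset_eball ?_
    rw [ENNReal.coe_le_coe]
    exact le_mul_of_one_le_left' (by norm_num)
  have hHle : H ≤ D * (H / μ B' * μ B) := by
    calc H = H / μ B' * μ B' := (ENNReal.div_mul_cancel hB'0 (measure_ne_top _ _)).symm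
      _ ≤ H / μ B' * (D * μ B) := by gcongr
      _ = D * (H / μ B' * μ B) := by ring
  calc 2 * (ENNReal.ofReal (72 * r) * H) = 144 * r * H := by
        rw [h72]
        ring
    _ ≤ 144 * r * (D * (H / μ B' * μ B)) := by gcongr
    _ = (144 * D) * (r * (H / μ B') * μ B) := by ring
    _ ≤ (144 * D + 1) * (r * (H / μ B') * μ B) := by gcongr; exact le_self_add
    _ = _ := by
        push_cast
        ring

end Poincare

theorem theorem1p3 (w : unitInterval) (hw0 : 0 < w) (hw1 : w < 1) :
    SupportsPoincareOneOne Laakso (laaksoMeasure w) := by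
  rw [laaksoMeasure_eq_map]
  have hmass : ∀ b, ProbabilityTheory.bernoulliMeasure false true w {b} ≠ 0 := by
    intro b
    rw [ProbabilityTheory.bernoulliMeasure_apply w (measurableSet_singleton b)]
    cases b
    · have h0 : (0 : ℝ) < w := hw0
      have h : unitInterval.toNNReal w ≠ 0 := fun h => h0.ne' (congrArg NNReal.toReal h)
      simpa using h
    · have h1 : (w : ℝ) < 1 := hw1
      have h : unitInterval.toNNReal (unitInterval.symm w) ≠ 0 := fun h =>
        (sub_pos.2 h1).ne' (congrArg NNReal.toReal h)
      simpa using h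
  -- The smaller of w and 1 - w serves as c; it is nonzero because 0 < w < 1.
  refine supportsPoincareOneOne_laaksoProductMeasure _
    (c := min (ProbabilityTheory.bernoulliMeasure false true w {false})
      (ProbabilityTheory.bernoulliMeasure false true w {true})) ?_ ?_
  · rcases min_choice (ProbabilityTheory.bernoulliMeasure false true w {false})
      (ProbabilityTheory.bernoulliMeasure false true w {true}) with h | h <;> rw [h]
    exacts [hmass _, hmass _]
  · rintro (_ | _)
    exacts [min_le_left _ _, min_le_right _ _]
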